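/- \textbf{Setting.} Let $\Lambda>0$, $k\in\mathbb R$ (the wave number), and let $\zeta,\zeta_p:\mathbb R\to\mathbb R$ be bounded Lipschitz functions, $\zeta$ being $\Lambda$-periodic. Let $\max\zeta<H_0<H$. For a height $h$ put $\Omega_h=\{x\in\mathbb R^2:\zeta(x_1)<x_2<h\}$ and $\Omega^p_h=\{x\in\mathbb R^2:\zeta_p(x_1)<x_2<h\}$; put $\Gamma=\{x_2=\zeta(x_1)\}$, $\Omega_H^\Lambda=\{x\in\Omega_H:-\Lambda/2<x_1\le\Lambda/2\}$ and $W^*=(-\pi/\Lambda,\pi/\Lambda]$. For $L\in\mathbb N$ let $\Omega_H^{L,\Lambda}=\bigcup_{j=-L+1}^{L}\big(\Omega_H^\Lambda+(\Lambda j,0)^\top\big)$. Let $\Theta_p$ be a homeomorphism of $\Omega_{H_0}$ onto $\Omega^p_{H_0}$ which is locally Lipschitz together with its inverse (for example a $C^1$ diffeomorphism), extended by the identity to $\mathbb R\times[H_0,\infty)$, and such that $$A_p=|\det\nabla\Theta_p|\,(\nabla\Theta_p)^{-1}(\nabla\Theta_p)^{-T}\in L^\infty(\Omega_H,\mathbb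 R^{2\times2}),\qquad c_p=|\det\nabla\Theta_p|\in L^\infty(\Omega_H).$$ Let $A_p^L=A_p$, $c_p^L=c_p$ in $\Omega_H^{L,\Lambda}$ and $A_p^L=I_2$, $c_p^L=1$ elsewhere. For $n\in\mathbb N=\{0,1,2,\dots\}$ let $H_0^n(W^*;\widetilde H^1_\alpha(\Omega_H^\Lambda))$ be the space of functions $w(\alpha,x)$ that are $2\pi/\Lambda$-periodic in $\alpha$ and $\alpha$-quasi-periodic in $x_1$, i.e. $w(\alpha,x+(\Lambda,0)^\top)=e^{i\alpha\Lambda}w(\alpha,x)$ (both in the Sobolev sense: the weak derivatives are those of the so extended function on $\mathbb R\times\Omega_H$), that vanish on $\Gamma$, and for which $$\|w\|_{H_0^n(W^*;\widetilde H^1_\alpha(\Omega_H^\Lambda))}=\Big(\sum_{m=0}^n\int_{W^*}\|\partial_\alpha^m w(\alpha,\cdot)\|_{H^1(\Omega_H^\Lambda)}^2\,d\alpha\Big)^{1/2}<\infty .$$ Write $L^2(W^*;\widetilde H^1_\alpha(\Omega_H^\Lambda))$ for the case $n=0$. The inverse Bloch transform is $$(\mathcal J^{-1}w)\big(x+(\Lambda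 j,0)^\top\big)=\sqrt{\tfrac{\Lambda}{2\pi}}\int_{W^*}w(\alpha,x)e^{i\alpha\Lambda j}\,d\alpha,\qquad x\in\Omega_H^\Lambda,\ j\in\mathbb Z .$$ Define $$b(w,z)=\int_{\Omega_H}\Big[(A_p-I_2)\nabla(\mathcal J^{-1}w)\cdot\nabla\overline{(\mathcal J^{-1}z)}-k^2(c_p-1)(\mathcal J^{-1}w)\,\overline{(\mathcal J^{-1}z)}\Big]dx,$$ and let $b^L(w,z)$ be the same expression with $A_p^L,c_p^L$ in place of $A_p,c_p$. \textbf{Lemma.} Let $n\in\mathbb N$. There are $C>0$ and $L_0\in\mathbb N$ such that for all integers $L\ge L_0$, all $w\in H_0^n(W^*;\widetilde H^1_\alpha(\Omega_H^\Lambda))$ and all $z\in L^2(W^*;\widetilde H^1_\alpha(\Omega_H^\Lambda))$, the weak gradients of $\mathcal J^{-1}w$ and $\mathcal J^{-1}z$ exist in $\Omega_H$, the integrals defining $b(w,z)$ and $b^L(w,z)$ converge absolutely, and $$\big|b^L(w,z)-b(w,z)\big|\le C\,|L\Lambda|^{-n}\,\|w\|_{H_0^n(W^*;\widetilde H^1_\alpha(\Omega_H^\Lambda))}\,\|z\|_{L^2(W^*;\widetilde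 H^1_\alpha(\Omega_H^\Lambda))}.$$ -/

import Mathlib

open MeasureTheory Set
open scoped ContDiff ComplexConjugate

noncomputable section

/-! ### Weak derivatives -/

/-- Smooth complex-valued test functions with compact support inside `U`. -/
def IsTestFunction {E : Type*} [NormedAddCommGroup E] [NormedSpace ℝ E]
    (U : Set E) (φ : E → ℂ) : Prop :=
  ContDiff ℝ ∞ φ ∧ HasCompactSupport φ ∧ tsupport φ ⊆ U

/-- `g` is a weak (distributional) derivative of `f` in the direction `v` on the open set `U`. -/
def IsWeakDeriv {E : Type*} [NormedAddCommGroup E] [NormedSpace ℝ E] [MeasureSpace E]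
    (U : Set E) (v : E) (f g : E → ℂ) : Prop :=
  LocallyIntegrableOn f U ∧ LocallyIntegrableOn g U ∧
    ∀ φ : E → ℂ, IsTestFunction U φ →
      ∫ p in U, f p * fderiv ℝ φ p v = -∫ p in U, g p * φ p

/-- `f` has a (locally integrable) weak derivative in the direction `v` on `U`. -/
def HasWeakDeriv {E : Type*} [NormedAddCommGroup E] [NormedSpace ℝ E] [MeasureSpace E]
    (U : Set E) (v : E) (f : E → ℂ) : Prop :=
  ∃ g : E → ℂ, IsWeakDeriv U v f g

open Classical in
/-- The weak derivative of `f` in the direction `v` on `U` (unique up to null subsets of `U`),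
and `0` if there is none. -/
def weakDeriv {E : Type*} [NormedAddCommGroup E] [NormedSpace ℝ E] [MeasureSpace E]
    (U : Set E) (v : E) (f : E → ℂ) : E → ℂ :=
  if h : HasWeakDeriv U v f then h.choose else 0

/-- The standard basis of the plane. -/
def basisVec (i : Fin 2) : ℝ × ℝ := ![(1, 0), (0, 1)] i

/-! ### Domains -/

/-- `Ω_H`: the points above the graph of `ζ` and below height `H`. -/
def stripDomain (ζ : ℝ → ℝ) (H : ℝ) : Set (ℝ × ℝ) :=
  {x | ζ x.1 < x.2 ∧ x.2 < H}

/-- `Ω^Λ_H`: one period of `Ω_H`. -/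
def cellDomain (Λ : ℝ) (ζ : ℝ → ℝ) (H : ℝ) : Set (ℝ × ℝ) :=
  stripDomain ζ H ∩ {x | x.1 ∈ Ioc (-(Λ / 2)) (Λ / 2)}

/-- The dual cell `W* = (-π/Λ, π/Λ]`. -/
def dualCell (Λ : ℝ) : Set ℝ := Ioc (-(Real.pi / Λ)) (Real.pi / Λ)

/-- `Ω^{L,Λ}_H`: the union of the translates of `Ω^Λ_H` by `(Λ j, 0)`, `j = -L+1, …, L`. -/
def truncDomain (Λ : ℝ) (ζ : ℝ → ℝ) (H : ℝ) (L : ℕ) : Set (ℝ × ℝ) :=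
  ⋃ j ∈ Icc (-(L : ℤ) + 1) (L : ℤ), (fun x : ℝ × ℝ => x + (Λ * (j : ℝ), 0)) '' cellDomain Λ ζ H

/-! ### The spaces `H_0^n(W*; H̃^1_α(Ω^Λ_H))`

Elements are represented by functions `w(α, x)` on `ℝ × Ω_H` which are `2π/Λ`-periodic in `α` and
`α`-quasi-periodic in `x₁`.  Norms are taken over `W* × Ω^Λ_H`; weak derivatives are taken
on all of `ℝ × Ω_H`, so that the periodicity in `α` and the quasi-periodicity in `x₁` hold in the
Sobolev sense (matching traces on opposite ends of the cells). -/

/-- The weak derivative `∂_α^m w` on `ℝ × Ω_H`. -/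
def alphaDeriv (ζ : ℝ → ℝ) (H : ℝ) (m : ℕ) (w : ℝ × (ℝ × ℝ) → ℂ) : ℝ × (ℝ × ℝ) → ℂ :=
  (weakDeriv (univ ×ˢ stripDomain ζ H) (1, 0))^[m] w

/-- The weak derivative `∂_{x_i} ∂_α^m w` on `ℝ × Ω_H`. -/
def mixedDeriv (ζ : ℝ → ℝ) (H : ℝ) (m : ℕ) (i : Fin 2) (w : ℝ × (ℝ × ℝ) → ℂ) :
    ℝ × (ℝ × ℝ) → ℂ :=
  weakDeriv (univ ×ˢ stripDomain ζ H) (0, basisVec i) (alphaDeriv ζ H m w)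

/-- Membership in `H_0^n(W*; H̃^1_α(Ω^Λ_H))`; for `n = 0` this is `L²(W*; H̃^1_α(Ω^Λ_H))`. -/
structure MemBlochSobolev (Λ : ℝ) (ζ : ℝ → ℝ) (H : ℝ) (n : ℕ) (w : ℝ × (ℝ × ℝ) → ℂ) :
    Prop where
  periodic : ∀ᵐ p ∂(volume.restrict (univ ×ˢ stripDomain ζ H)),
    w (p.1 + 2 * Real.pi / Λ, p.2) = w p
  quasiPeriodic : ∀ᵐ p ∂(volume.restrict (univ ×ˢ stripDomain ζ H)),
    w (p.1, p.2 + (Λ, 0)) = Complex.exp (Complex.I * p.1 * Λ) * w p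
  hasAlphaDeriv : ∀ m < n,
    HasWeakDeriv (univ ×ˢ stripDomain ζ H) (1, 0) (alphaDeriv ζ H m w)
  hasMixedDeriv : ∀ m ≤ n, ∀ i : Fin 2,
    HasWeakDeriv (univ ×ˢ stripDomain ζ H) (0, basisVec i) (alphaDeriv ζ H m w)
  memLp_alphaDeriv : ∀ m ≤ n,
    MemLp (alphaDeriv ζ H m w) 2 (volume.restrict (dualCell Λ ×ˢ cellDomain Λ ζ H))
  memLp_mixedDeriv : ∀ m ≤ n, ∀ i : Fin 2,
    MemLp (mixedDeriv ζ H m i w) 2 (volume.restrict (dualCell Λ ×ˢ cellDomain Λ ζ H))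
  /-- Homogeneous Dirichlet condition on the graph of `ζ`: the extension of `w` by zero across the
  graph still has an `x`-gradient, namely the extension by zero of the `x`-gradient of `w`. -/
  dirichlet : ∀ i : Fin 2,
    IsWeakDeriv (univ ×ˢ {x : ℝ × ℝ | x.2 < H}) (0, basisVec i)
      ((univ ×ˢ stripDomain ζ H).indicator w)
      ((univ ×ˢ stripDomain ζ H).indicator (mixedDeriv ζ H 0 i w))

/-- The norm of `H_0^n(W*; H̃^1_α(Ω^Λ_H))`: the square root of
`∑_{m ≤ n} ∫_{W*} ‖∂_α^m w(α, ·)‖²_{H^1(Ω^Λ_H)} dα`. -/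
def blochSobolevNorm (Λ : ℝ) (ζ : ℝ → ℝ) (H : ℝ) (n : ℕ) (w : ℝ × (ℝ × ℝ) → ℂ) : ℝ :=
  Real.sqrt (∑ m ∈ Finset.range (n + 1), ∫ p in dualCell Λ ×ˢ cellDomain Λ ζ H,
    (‖alphaDeriv ζ H m w p‖ ^ 2 + ∑ i : Fin 2, ‖mixedDeriv ζ H m i w p‖ ^ 2))

/-! ### The inverse Bloch transform -/

/-- The integer `j` with `t - Λ j ∈ (-Λ/2, Λ/2]`. -/
def cellIndex (Λ t : ℝ) : ℤ := ⌈t / Λ - 1 / 2⌉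

/-- The inverse Bloch transform
`(J⁻¹ψ)(x + (Λ j, 0)) = C_Λ ∫_{W*} ψ(α, x) e^{iαΛj} dα` for `x` in the cell `Ω^Λ_H` and `j ∈ ℤ`,
where `C_Λ = √(Λ / 2π)`. -/
def invBloch (Λ : ℝ) (ψ : ℝ × (ℝ × ℝ) → ℂ) (y : ℝ × ℝ) : ℂ :=
  (Real.sqrt (Λ / (2 * Real.pi)) : ℂ) *
    ∫ α in dualCell Λ, ψ (α, y - (Λ * (cellIndex Λ y.1 : ℝ), 0)) *
      Complex.exp (Complex.I * α * Λ * (cellIndex Λ y.1 : ℂ))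

/-! ### The coefficients -/

/-- `Θ` is a homeomorphism of `Ω_{H₀}` onto `Ω^p_{H₀}`, locally Lipschitz together with its inverse
(for instance a `C¹` diffeomorphism), extended by the identity to heights `≥ H₀`. -/
structure IsDomainMap (ζ ζp : ℝ → ℝ) (H₀ : ℝ) (Θ : ℝ × ℝ → ℝ × ℝ) : Prop where
  mapsTo : MapsTo Θ (stripDomain ζ H₀) (stripDomain ζp H₀)
  lipschitz : LocallyLipschitzOn (stripDomain ζ H₀) Θ
  inverse : ∃ Ψ : ℝ × ℝ → ℝ × ℝ, MapsTo Ψ (stripDomain ζp H₀) (stripDomain ζ H₀) ∧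
    LocallyLipschitzOn (stripDomain ζp H₀) Ψ ∧
    InvOn Ψ Θ (stripDomain ζ H₀) (stripDomain ζp H₀)
  eq_self : ∀ x : ℝ × ℝ, H₀ ≤ x.2 → Θ x = x

/-- The Jacobian matrix `∇Θ`. -/
def jacobian (Θ : ℝ × ℝ → ℝ × ℝ) (x : ℝ × ℝ) : Matrix (Fin 2) (Fin 2) ℝ :=
  !![(fderiv ℝ Θ x (1, 0)).1, (fderiv ℝ Θ x (0, 1)).1;
     (fderiv ℝ Θ x (1, 0)).2, (fderiv ℝ Θ x (0, 1)).2]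

/-- `A_p = |det ∇Θ| (∇Θ)⁻¹ (∇Θ)⁻ᵀ`. -/
def coeffA (Θ : ℝ × ℝ → ℝ × ℝ) (x : ℝ × ℝ) : Matrix (Fin 2) (Fin 2) ℝ :=
  |(jacobian Θ x).det| • ((jacobian Θ x)⁻¹ * ((jacobian Θ x)⁻¹).transpose)

/-- `c_p = |det ∇Θ|`. -/
def coeffC (Θ : ℝ × ℝ → ℝ × ℝ) (x : ℝ × ℝ) : ℝ := |(jacobian Θ x).det|

open Classical in
/-- `A` cut off (replaced by the identity matrix) outside `S`. -/
def cutA (S : Set (ℝ × ℝ)) (A : ℝ × ℝ → Matrix (Fin 2) (Fin 2) ℝ) (x : ℝ × ℝ) :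
    Matrix (Fin 2) (Fin 2) ℝ := if x ∈ S then A x else 1

open Classical in
/-- `c` cut off (replaced by `1`) outside `S`. -/
def cutC (S : Set (ℝ × ℝ)) (c : ℝ × ℝ → ℝ) (x : ℝ × ℝ) : ℝ := if x ∈ S then c x else 1

/-! ### The sesquilinear forms -/

/-- The integrand
`(A - I) ∇(J⁻¹w) · ∇(conj (J⁻¹z)) - k² (c - 1) (J⁻¹w) conj (J⁻¹z)`. -/
def formIntegrand (Λ k : ℝ) (ζ : ℝ → ℝ) (H : ℝ) (A : ℝ × ℝ → Matrix (Fin 2) (Fin 2) ℝ)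
    (c : ℝ × ℝ → ℝ) (w z : ℝ × (ℝ × ℝ) → ℂ) (x : ℝ × ℝ) : ℂ :=
  (∑ i : Fin 2, ∑ j : Fin 2, (((A x - 1) i j : ℝ) : ℂ) *
      weakDeriv (stripDomain ζ H) (basisVec j) (invBloch Λ w) x *
      conj (weakDeriv (stripDomain ζ H) (basisVec i) (invBloch Λ z) x))
    - ((k ^ 2 * (c x - 1) : ℝ) : ℂ) * invBloch Λ w x * conj (invBloch Λ z x)

/-- The form with coefficients `A`, `c`: the integral of `formIntegrand` over `Ω_H`. -/
def sesqForm (Λ k : ℝ) (ζ : ℝ → ℝ) (H : ℝ) (A : ℝ × ℝ → Matrix (Fin 2) (Fin 2) ℝ)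
    (c : ℝ × ℝ → ℝ) (w z : ℝ × (ℝ × ℝ) → ℂ) : ℂ :=
  ∫ x in stripDomain ζ H, formIntegrand Λ k ζ H A c w z x

/-- `b(w, z)`. -/
def formB (Λ k : ℝ) (ζ : ℝ → ℝ) (H : ℝ) (Θ : ℝ × ℝ → ℝ × ℝ) (w z : ℝ × (ℝ × ℝ) → ℂ) : ℂ :=
  sesqForm Λ k ζ H (coeffA Θ) (coeffC Θ) w z

/-- `b^L(w, z)`: the coefficients `A_p`, `c_p` are cut off outside `Ω^{L,Λ}_H`. -/
def formBL (Λ k : ℝ) (ζ : ℝ → ℝ) (H : ℝ) (Θ : ℝ × ℝ → ℝ × ℝ) (L : ℕ)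
    (w z : ℝ × (ℝ × ℝ) → ℂ) : ℂ :=
  sesqForm Λ k ζ H (cutA (truncDomain Λ ζ H L) (coeffA Θ))
    (cutC (truncDomain Λ ζ H L) (coeffC Θ)) w z

end

/-! On the `j`-th translate of the cell, `J⁻¹w` is the `j`-th Fourier coefficient of `α ↦ w(α, y)`,
so regularity in `α` is decay in `j`. Each integration by parts over the dual cell has no boundary
term, by periodicity; hence the coefficient of `∂_α^n w` is `(-iΛj)^n` times that of `w`
(`blochCoeff_weakDeriv`, `MemBlochSobolev.blochCoeff_alphaDeriv`).

The cut-off coefficients contribute nothing outside `Ω^{L,Λ}_H`, so `b^L - b` is minus an integral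
over the tail, where only cells with `|j| ≥ L` occur. There the identity gains `(LΛ)^{-n}`, and
Bessel's inequality, summed over the cells, bounds `J⁻¹w` in `L²` by `∂_α^n w`
(`IsBlochPair.eLpNorm_le`). The same estimate without `α`-derivatives controls `J⁻¹z`, and
Cauchy–Schwarz with the `L^∞` bounds on the coefficients concludes.

Gradients need the same bounds. By quasi-periodicity `J⁻¹w` agrees a.e. on all of `Ω_H` with the
zeroth coefficient (`MemBlochSobolev.invBloch_ae_eq`), an integral over `α` that commutes with weak
`x`-derivatives; so nothing jumps between cells. Decay then passes to the gradient by uniqueness of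
weak derivatives (`MemBlochSobolev.blochCoeff_mixedDeriv`).

Weak derivatives on `ℝ × Ω_H` are known only through test functions. Statements for a.e. `α` or a.e.
`y` come from products `χ(α)φ(y)`, and a smooth bump replaces the sharp cut-off to one period. -/

noncomputable section

/-! ### Basic properties of weak derivatives -/

section Translation

variable {E : Type*} [NormedAddCommGroup E] [MeasureSpace E] [BorelSpace E]
  [(volume : Measure E).IsAddHaarMeasure]

theorem measurePreserving_add_restrict {U : Set E} {a : E} (ha : ∀ x, x + a ∈ U ↔ x ∈ U) :
    MeasurePreserving (fun x => x + a) (volume.restrict U) (volume.restrict U) := by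
  have h := (measurePreserving_add_right (volume : Measure E) a).restrict_preimage_emb
    (MeasurableEquiv.addRight a).measurableEmbedding U
  have h2 : (fun x => x + a) ⁻¹' U = U := by ext x; exact ha x
  rwa [h2] at h

theorem setIntegral_comp_add {U : Set E} {a : E} (ha : ∀ x, x + a ∈ U ↔ x ∈ U) (F : E → ℂ) :
    ∫ x in U, F (x + a) = ∫ x in U, F x :=
  (measurePreserving_add_restrict ha).integral_comp
    (MeasurableEquiv.addRight a).measurableEmbedding F

theorem LocallyIntegrableOn.comp_add {U : Set E} {a : E} {f : E → ℂ}
    (ha : ∀ x, x + a ∈ U ↔ x ∈ U) (hf : LocallyIntegrableOn f U) :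
    LocallyIntegrableOn (fun x => f (x + a)) U := by
  intro x hx
  obtain ⟨s, hs, hs'⟩ := hf (x + a) ((ha x).2 hx)
  refine ⟨(fun x => x + a) ⁻¹' s, ?_, ?_⟩
  · have : Filter.Tendsto (fun x => x + a) (nhdsWithin x U) (nhdsWithin (x + a) U) :=
      tendsto_nhdsWithin_iff.2 ⟨((continuous_add_const a).tendsto x).mono_left nhdsWithin_le_nhds,
        by filter_upwards [self_mem_nhdsWithin] with y hy using (ha y).2 hy⟩
    exact this hs
  · exact ((measurePreserving_add_right volume a).integrableOn_comp_preimage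
      (MeasurableEquiv.addRight a).measurableEmbedding).2 hs'

end Translation

section WeakDerivatives

variable {E : Type*} [NormedAddCommGroup E] [NormedSpace ℝ E]

/-- A locally integrable function times a continuous function that vanishes off a compact set is
integrable. -/
theorem LocallyIntegrableOn.integrableOn_mul_of_eq_zero {X : Type*} [TopologicalSpace X]
    [T2Space X] [MeasurableSpace X] [OpensMeasurableSpace X] [SecondCountableTopology X]
    {μ : Measure X} {f ψ : X → ℂ} {U K S : Set X} (hf : LocallyIntegrableOn f U μ)
    (hK : IsCompact K) (hKU : K ⊆ U) (hS : MeasurableSet S) (hψ : Continuous ψ)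
    (h0 : ∀ p ∈ S \ K, ψ p = 0) : IntegrableOn (fun p => f p * ψ p) S μ := by
  refine IntegrableOn.of_forall_sdiff_eq_zero
    ((hf.integrableOn_compact_subset hKU hK).mul_continuousOn hψ.continuousOn hK) hS ?_
  intro p hp
  simp [h0 p hp]

theorem IsTestFunction.continuous {U : Set E} {φ : E → ℂ} (hφ : IsTestFunction U φ) :
    Continuous φ := hφ.1.continuous

theorem IsTestFunction.continuous_fderiv {U : Set E} {φ : E → ℂ} (hφ : IsTestFunction U φ)
    (v : E) : Continuous fun p => fderiv ℝ φ p v :=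
  (hφ.1.continuous_fderiv (by simp)).clm_apply continuous_const

theorem fderiv_eq_zero_of_notMem_tsupport {φ : E → ℂ} {p : E} (hp : p ∉ tsupport φ) :
    fderiv ℝ φ p = 0 :=
  image_eq_zero_of_notMem_tsupport fun h => hp (tsupport_fderiv_subset ℝ h)

theorem isTestFunction_ofReal {U : Set E} {g : E → ℝ} (hg : ContDiff ℝ ∞ g)
    (hc : HasCompactSupport g) (hU : tsupport g ⊆ U) :
    IsTestFunction U fun x => (g x : ℂ) := by
  have h : (tsupport fun x => (g x : ℂ)) = tsupport g := by
    simp only [tsupport]; congr 1; ext; simp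
  refine ⟨Complex.ofRealCLM.contDiff.comp hg, ?_, h ▸ hU⟩
  rw [HasCompactSupport, h]; exact hc

variable [MeasureSpace E]

theorem HasWeakDeriv.isWeakDeriv {U : Set E} {v : E} {f : E → ℂ} (h : HasWeakDeriv U v f) :
    IsWeakDeriv U v f (weakDeriv U v f) := by
  rw [weakDeriv, dif_pos h]; exact h.choose_spec

theorem LocallyIntegrableOn.congr_ae_restrict {X : Type*} [TopologicalSpace X] [MeasurableSpace X]
    {μ : Measure X} {f g : X → ℂ} {U : Set X}
    (hf : LocallyIntegrableOn f U μ) (h : f =ᵐ[μ.restrict U] g) : LocallyIntegrableOn g U μ := by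
  intro x hx
  obtain ⟨s, hs, hs'⟩ := hf x hx
  refine ⟨s ∩ U, Filter.inter_mem hs self_mem_nhdsWithin, ?_⟩
  exact (hs'.mono_set inter_subset_left).congr (ae_restrict_of_ae_restrict_of_subset
    inter_subset_right h)

theorem IsWeakDeriv.congr {U : Set E} {v : E} {f f' g g' : E → ℂ}
    (h : IsWeakDeriv U v f g) (hf : f =ᵐ[volume.restrict U] f')
    (hg : g =ᵐ[volume.restrict U] g') : IsWeakDeriv U v f' g' := by
  refine ⟨LocallyIntegrableOn.congr_ae_restrict h.1 hf,
    LocallyIntegrableOn.congr_ae_restrict h.2.1 hg, fun φ hφ => ?_⟩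
  rw [integral_congr_ae (g := fun p => f p * fderiv ℝ φ p v) (by
      filter_upwards [hf] with p hp; rw [hp]), h.2.2 φ hφ]
  congr 1
  refine integral_congr_ae ?_
  filter_upwards [hg] with p hp
  rw [hp]

theorem IsWeakDeriv.const_mul {U : Set E} {v : E} {f g : E → ℂ} (c : ℂ)
    (h : IsWeakDeriv U v f g) : IsWeakDeriv U v (fun x => c * f x) (fun x => c * g x) := by
  refine ⟨h.1.smul c, h.2.1.smul c, fun φ hφ => ?_⟩
  simp only [mul_assoc]
  rw [integral_const_mul, integral_const_mul, h.2.2 φ hφ, mul_neg]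

section FiniteDimensional

variable [BorelSpace E] [FiniteDimensional ℝ E]

theorem IsTestFunction.integrableOn_mul {U : Set E} {f φ : E → ℂ} (hU : MeasurableSet U)
    (hf : LocallyIntegrableOn f U) (hφ : IsTestFunction U φ) :
    IntegrableOn (fun p => f p * φ p) U :=
  LocallyIntegrableOn.integrableOn_mul_of_eq_zero hf hφ.2.1 hφ.2.2 hU hφ.continuous
    fun _ hp => image_eq_zero_of_notMem_tsupport hp.2

theorem IsTestFunction.integrableOn_mul_fderiv {U : Set E} {f φ : E → ℂ} (hU : MeasurableSet U)
    (hf : LocallyIntegrableOn f U) (hφ : IsTestFunction U φ) (v : E) :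
    IntegrableOn (fun p => f p * fderiv ℝ φ p v) U :=
  LocallyIntegrableOn.integrableOn_mul_of_eq_zero hf hφ.2.1 hφ.2.2 hU (hφ.continuous_fderiv v)
    fun _ hp => by simp [fderiv_eq_zero_of_notMem_tsupport hp.2]

/-- The fundamental lemma of the calculus of variations, with complex test functions. -/
theorem ae_eq_zero_of_forall_isTestFunction {U : Set E} {f : E → ℂ} (hU : IsOpen U)
    (hf : LocallyIntegrableOn f U)
    (h : ∀ φ : E → ℂ, IsTestFunction U φ → ∫ p in U, f p * φ p = 0) :
    ∀ᵐ p ∂volume.restrict U, f p = 0 := by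
  rw [ae_restrict_iff' hU.measurableSet]
  refine hU.ae_eq_zero_of_integral_contDiff_smul_eq_zero hf fun g hg hc hs => ?_
  rw [← h _ (isTestFunction_ofReal hg hc hs), ← setIntegral_eq_integral_of_forall_compl_eq_zero (s := U)]
  · simp [mul_comm]
  · intro x hx
    rw [image_eq_zero_of_notMem_tsupport fun hx' => hx (hs hx'), zero_smul]

theorem IsWeakDeriv.unique {U : Set E} {v : E} {f g g' : E → ℂ} (hU : IsOpen U)
    (h : IsWeakDeriv U v f g) (h' : IsWeakDeriv U v f g') : g =ᵐ[volume.restrict U] g' := by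
  have := ae_eq_zero_of_forall_isTestFunction hU (h.2.1.sub h'.2.1) fun φ hφ => by
    simp only [Pi.sub_apply, sub_mul]
    rw [integral_sub (hφ.integrableOn_mul hU.measurableSet h.2.1)
      (hφ.integrableOn_mul hU.measurableSet h'.2.1), ← neg_eq_iff_eq_neg.mpr (h.2.2 φ hφ),
      ← neg_eq_iff_eq_neg.mpr (h'.2.2 φ hφ), sub_self]
  filter_upwards [this] with p hp
  exact sub_eq_zero.mp hp

end FiniteDimensional

variable [BorelSpace E] [(volume : Measure E).IsAddHaarMeasure]

/-- The translation is moved onto the test function. Together with uniqueness this carries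
periodicity from a function to its weak derivatives. -/
theorem IsWeakDeriv.comp_add {U : Set E} {v a : E} {f g : E → ℂ}
    (ha : ∀ x, x + a ∈ U ↔ x ∈ U) (h : IsWeakDeriv U v f g) :
    IsWeakDeriv U v (fun x => f (x + a)) (fun x => g (x + a)) := by
  refine ⟨LocallyIntegrableOn.comp_add ha h.1, LocallyIntegrableOn.comp_add ha h.2.1,
    fun φ hφ => ?_⟩
  have hψ : IsTestFunction U fun x => φ (x - a) := by
    refine ⟨hφ.1.comp (contDiff_id.sub contDiff_const), ?_, ?_⟩
    · exact hφ.2.1.comp_homeomorph (Homeomorph.subRight a)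
    · intro x hx
      have h1 := tsupport_comp_subset_preimage φ (continuous_sub_right a) hx
      have h2 := hφ.2.2 h1
      have := (ha (x - a)).2 h2
      simpa using this
  have h3 := h.2.2 _ hψ
  rw [← setIntegral_comp_add ha, ← setIntegral_comp_add ha (fun x => g x * φ (x - a))] at h3
  simpa [fderiv_comp_sub] using h3

end WeakDerivatives

/-! ### Fibre integrals on cylinders -/

theorem volume_restrict_prod {X : Type*} [MeasureSpace X] [SigmaFinite (volume : Measure X)]
    (S : Set ℝ) (Ω : Set X) : (volume : Measure (ℝ × X)).restrict (S ×ˢ Ω) =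
      (volume.restrict S).prod (volume.restrict Ω) :=
  (Measure.prod_restrict S Ω).symm

section Marginals

variable {X : Type*} [NormedAddCommGroup X] [MeasureSpace X] [BorelSpace X]
  [SecondCountableTopology X] [SigmaFinite (volume : Measure X)]

/-- Supplies the integrability for Fubini: on `S ×ˢ Ω` the factor `ψ` lives on the compact set `I ×ˢ
K`. -/
theorem LocallyIntegrableOn.integrableOn_slab {Ω : Set X} {f : ℝ × X → ℂ} {ψ : ℝ × X → ℂ}
    {K : Set X} {I S : Set ℝ} (hΩ : MeasurableSet Ω)
    (hf : LocallyIntegrableOn f (univ ×ˢ Ω)) (hK : IsCompact K) (hKΩ : K ⊆ Ω)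
    (hI : IsCompact I) (hS : MeasurableSet S) (hψ : Continuous ψ)
    (h0 : ∀ p : ℝ × X, p.1 ∈ S → p.2 ∈ Ω → p ∉ I ×ˢ K → ψ p = 0) :
    Integrable (fun p => f p * ψ p) ((volume.restrict S).prod (volume.restrict Ω)) := by
  rw [← volume_restrict_prod]
  exact LocallyIntegrableOn.integrableOn_mul_of_eq_zero hf (hI.prod hK)
    (prod_mono (subset_univ _) hKΩ) (hS.prod hΩ) hψ fun p hp => h0 p hp.1.1 hp.1.2 hp.2

theorem LocallyIntegrableOn.integral_fiber {Ω : Set X} {f : ℝ × X → ℂ} {e : ℝ → ℂ}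
    (hΩ : IsOpen Ω) [LocallyCompactSpace X] (hf : LocallyIntegrableOn f (univ ×ˢ Ω))
    (he : Continuous e) (a b : ℝ) :
    LocallyIntegrableOn (fun y => ∫ α in Ioc a b, f (α, y) * e α) Ω := by
  rw [locallyIntegrableOn_iff hΩ.isLocallyClosed]
  intro K hKΩ hK
  have h : Integrable (fun p : ℝ × X => f p * e p.1)
      ((volume.restrict (Ioc a b)).prod (volume.restrict K)) := by
    rw [← volume_restrict_prod]
    refine LocallyIntegrableOn.integrableOn_mul_of_eq_zero (K := Icc a b ×ˢ K) hf
      (isCompact_Icc.prod hK)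
      (prod_mono (subset_univ _) hKΩ) (measurableSet_Ioc.prod hK.measurableSet)
      (he.comp continuous_fst) fun p hp => (hp.2 ⟨Ioc_subset_Icc_self hp.1.1, hp.1.2⟩).elim
  exact h.integral_prod_right

theorem LocallyIntegrableOn.locallyIntegrable_marginal {Ω : Set X} {f : ℝ × X → ℂ} {φ : X → ℂ}
    (hΩ : MeasurableSet Ω) (hf : LocallyIntegrableOn f (univ ×ˢ Ω)) (hφ : Continuous φ)
    {K : Set X} (hK : IsCompact K) (hKΩ : K ⊆ Ω) (h0 : ∀ y ∉ K, φ y = 0) :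
    LocallyIntegrable fun α => ∫ y in Ω, f (α, y) * φ y := by
  rw [locallyIntegrable_iff]
  intro I hI
  have h := LocallyIntegrableOn.integrableOn_slab (ψ := fun p => φ p.2) hΩ hf hK hKΩ hI
    hI.measurableSet (hφ.comp continuous_snd) fun p h1 _ h2 => h0 _ fun h3 => h2 ⟨h1, h3⟩
  exact h.integral_prod_left

/-- Fubini. Testing a marginal against `χ` amounts to testing `f` against the product `χ(α)φ(y)`. -/
theorem integral_mul_marginal {Ω : Set X} {f : ℝ × X → ℂ} {φ : X → ℂ} {χ : ℝ → ℂ}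
    (hΩ : MeasurableSet Ω) (hf : LocallyIntegrableOn f (univ ×ˢ Ω)) (hφ : Continuous φ)
    {K : Set X} (hK : IsCompact K) (hKΩ : K ⊆ Ω) (h0 : ∀ y ∉ K, φ y = 0)
    (hχ : Continuous χ) (hχc : HasCompactSupport χ) :
    ∫ α, (∫ y in Ω, f (α, y) * φ y) * χ α =
      ∫ p in univ ×ˢ Ω, f p * (χ p.1 * φ p.2) := by
  have h := LocallyIntegrableOn.integrableOn_slab (ψ := fun p => χ p.1 * φ p.2) (S := univ)
    hΩ hf hK hKΩ hχc MeasurableSet.univ (by fun_prop) fun p h1 _ h2 => by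
      by_cases h3 : p.2 ∈ K
      · rw [image_eq_zero_of_notMem_tsupport fun h4 => h2 ⟨h4, h3⟩, zero_mul]
      · rw [h0 _ h3, mul_zero]
  rw [volume_restrict_prod, integral_prod _ h, Measure.restrict_univ]
  congr 1; ext α
  rw [← integral_mul_const]
  congr 1; ext y
  ring

theorem integral_fiber_mul {Ω : Set X} {f : ℝ × X → ℂ} {φ : X → ℂ} {e : ℝ → ℂ}
    (hΩ : MeasurableSet Ω) (hf : LocallyIntegrableOn f (univ ×ˢ Ω)) (hφ : Continuous φ)
    {K : Set X} (hK : IsCompact K) (hKΩ : K ⊆ Ω) (h0 : ∀ y ∉ K, φ y = 0)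
    (he : Continuous e) (a b : ℝ) :
    ∫ y in Ω, (∫ α in Ioc a b, f (α, y) * e α) * φ y =
      ∫ α in Ioc a b, (∫ y in Ω, f (α, y) * φ y) * e α := by
  have h := LocallyIntegrableOn.integrableOn_slab (ψ := fun p => e p.1 * φ p.2) (S := Ioc a b)
    (I := Icc a b) hΩ hf hK hKΩ isCompact_Icc measurableSet_Ioc (by fun_prop)
    fun p h1 _ h2 => by
      rw [h0 _ fun h3 => h2 ⟨Ioc_subset_Icc_self h1, h3⟩, mul_zero]
  simp_rw [← integral_mul_const]
  rw [integral_integral_swap (f := fun y α => f (α, y) * e α * φ y)]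
  · congr 1; ext α; congr 1; ext y; ring
  · have := h.swap
    convert this using 1
    ext p
    simp only [Function.uncurry, mul_assoc, Function.comp_apply]
    rfl

end Marginals

section Fiber

variable {X : Type*} [NormedAddCommGroup X] [NormedSpace ℝ X]

theorem IsTestFunction.prod_mul {Ω : Set X} {χ : ℝ → ℂ} {φ : X → ℂ}
    (hχ : IsTestFunction univ χ) (hφ : IsTestFunction Ω φ) :
    IsTestFunction (univ ×ˢ Ω) fun p : ℝ × X => χ p.1 * φ p.2 := by
  have hsub : (tsupport fun p : ℝ × X => χ p.1 * φ p.2) ⊆ tsupport χ ×ˢ tsupport φ := by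
    refine closure_minimal ?_ ((isClosed_tsupport _).prod (isClosed_tsupport _))
    intro p hp
    have := mul_ne_zero_iff.1 (Function.mem_support.1 hp)
    exact ⟨subset_tsupport _ this.1, subset_tsupport _ this.2⟩
  refine ⟨(hχ.1.comp contDiff_fst).mul (hφ.1.comp contDiff_snd), ?_, ?_⟩
  · exact (hχ.2.1.prod hφ.2.1).of_isClosed_subset (isClosed_tsupport _) hsub
  · exact hsub.trans (prod_mono (subset_univ _) hφ.2.2)

theorem fderiv_prod_mul_apply {χ : ℝ → ℂ} {φ : X → ℂ} (hχ : ContDiff ℝ ∞ χ) (hφ : ContDiff ℝ ∞ φ)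
    (p v : ℝ × X) : fderiv ℝ (fun p : ℝ × X => χ p.1 * φ p.2) p v =
      χ p.1 * fderiv ℝ φ p.2 v.2 + fderiv ℝ χ p.1 v.1 * φ p.2 := by
  have h1 : HasFDerivAt (fun p : ℝ × X => χ p.1) _ p :=
    ((hχ.differentiable (by simp)) p.1).hasFDerivAt.comp p hasFDerivAt_fst
  have h2 : HasFDerivAt (fun p : ℝ × X => φ p.2) _ p :=
    ((hφ.differentiable (by simp)) p.2).hasFDerivAt.comp p hasFDerivAt_snd
  rw [(h1.fun_mul h2).fderiv]
  simp [mul_comm]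

variable [MeasureSpace X] [BorelSpace X] [SecondCountableTopology X]
  [SigmaFinite (volume : Measure X)]

variable [FiniteDimensional ℝ X]

/-- Integration over the first factor commutes with weak derivatives in the second one. -/
theorem IsWeakDeriv.integral_fiber {Ω : Set X} {v : X} {f g : ℝ × X → ℂ} {e : ℝ → ℂ}
    (hΩ : IsOpen Ω) (h : IsWeakDeriv (univ ×ˢ Ω) ((0 : ℝ), v) f g) (he : Continuous e) (a b : ℝ) :
    IsWeakDeriv Ω v (fun y => ∫ α in Ioc a b, f (α, y) * e α)
      (fun y => ∫ α in Ioc a b, g (α, y) * e α) := by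
  have : LocallyCompactSpace X := have := FiniteDimensional.proper ℝ X; inferInstance
  refine ⟨LocallyIntegrableOn.integral_fiber hΩ h.1 he a b,
    LocallyIntegrableOn.integral_fiber hΩ h.2.1 he a b, fun φ hφ => ?_⟩
  have h0 : ∀ y ∉ tsupport φ, φ y = 0 := fun y hy => image_eq_zero_of_notMem_tsupport hy
  have h0' : ∀ y ∉ tsupport φ, fderiv ℝ φ y v = 0 := fun y hy => by
    simp [fderiv_eq_zero_of_notMem_tsupport hy]
  have hm := hΩ.measurableSet
  have l1 := LocallyIntegrableOn.locallyIntegrable_marginal hm h.1 (hφ.continuous_fderiv v)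
    hφ.2.1 hφ.2.2 h0'
  have l2 := LocallyIntegrableOn.locallyIntegrable_marginal hm h.2.1 hφ.continuous
    hφ.2.1 hφ.2.2 h0
  -- The function `e` cut off to `(a, b]` is not smooth, so it cannot serve as a test function in
  -- `α`. Smooth `χ` first give the identity of marginals for a.e. `α`; it is then multiplied by `e`
  -- and integrated over `(a, b]`.
  have key := ae_eq_zero_of_forall_isTestFunction isOpen_univ
    (locallyIntegrableOn_univ.2 (l1.add l2)) fun χ hχ => by
      rw [Measure.restrict_univ]
      simp only [Pi.add_apply, add_mul]
      have i1 := hχ.integrableOn_mul MeasurableSet.univ (locallyIntegrableOn_univ.2 l1)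
      have i2 := hχ.integrableOn_mul MeasurableSet.univ (locallyIntegrableOn_univ.2 l2)
      rw [integrableOn_univ] at i1 i2
      rw [integral_add i1 i2,
        integral_mul_marginal hm h.1 (hφ.continuous_fderiv v) hφ.2.1 hφ.2.2 h0' hχ.continuous
          hχ.2.1,
        integral_mul_marginal hm h.2.1 hφ.continuous hφ.2.1 hφ.2.2 h0 hχ.continuous hχ.2.1]
      have := h.2.2 _ (hχ.prod_mul hφ)
      simp only [fderiv_prod_mul_apply hχ.1 hφ.1, map_zero, zero_mul, add_zero] at this
      rw [this]; ring
  rw [integral_fiber_mul hm h.1 (hφ.continuous_fderiv v) hφ.2.1 hφ.2.2 h0' he,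
    integral_fiber_mul hm h.2.1 hφ.continuous hφ.2.1 hφ.2.2 h0 he, ← integral_neg]
  refine integral_congr_ae ?_
  rw [Measure.restrict_univ] at key
  filter_upwards [ae_restrict_of_ae key] with α hα
  rw [← neg_mul]
  exact congrArg (· * e α) (eq_neg_of_add_eq_zero_left hα)

end Fiber

/-! ### Integration by parts over one period -/

section Periodic

/-- The smooth bump `η(t - a) - η(t - a - P)`, with `η` the smooth step from `0` to `1`: its
translates by multiples of `P` add up to `1`. -/
def periodBump (a P t : ℝ) : ℂ :=
  (Real.smoothTransition (t - a) : ℂ) - (Real.smoothTransition (t - P - a) : ℂ)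

theorem contDiff_smoothTransition_sub (a : ℝ) :
    ContDiff ℝ ∞ fun t : ℝ => (Real.smoothTransition (t - a) : ℂ) :=
  Complex.ofRealCLM.contDiff.comp
    (Real.smoothTransition.contDiff.comp (contDiff_id.sub contDiff_const))

theorem isTestFunction_periodBump (a : ℝ) {P : ℝ} (hP : 0 < P) :
    IsTestFunction univ (periodBump a P) := by
  refine ⟨(contDiff_smoothTransition_sub a).sub
    ((contDiff_smoothTransition_sub a).comp (contDiff_id.sub contDiff_const)), ?_, subset_univ _⟩
  refine HasCompactSupport.intro (K := Icc a (a + P + 1)) isCompact_Icc fun t ht => ?_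
  rw [mem_Icc, not_and_or, not_le, not_le] at ht
  rcases ht with ht | ht
  · simp [periodBump, Real.smoothTransition.zero_of_nonpos (show t - a ≤ 0 by linarith),
      Real.smoothTransition.zero_of_nonpos (show t - P - a ≤ 0 by linarith)]
  · simp [periodBump, Real.smoothTransition.one_of_one_le (show 1 ≤ t - a by linarith),
      Real.smoothTransition.one_of_one_le (show 1 ≤ t - P - a by linarith)]

/-- Periodicity replaces `r(t - P) k(t)` by `r(t - P) k(t - P)`, whose integral is that of `r k` by
translation invariance. -/
theorem integral_sub_translate_mul {k r : ℝ → ℂ} {P : ℝ}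
    (hper : ∀ᵐ t, k (t + P) = k t) (hi : Integrable fun t => r t * k t) :
    Integrable (fun t => (r t - r (t - P)) * k t) ∧ ∫ t, (r t - r (t - P)) * k t = 0 := by
  have hper' : ∀ᵐ t, k t = k (t - P) := by
    have := (measurePreserving_sub_right (volume : Measure ℝ) P).quasiMeasurePreserving.ae hper
    simpa using this
  have hae : (fun t => r (t - P) * k (t - P)) =ᵐ[volume] fun t => r (t - P) * k t := by
    filter_upwards [hper'] with t ht
    rw [← ht]
  have hi' : Integrable fun t => r (t - P) * k t :=
    (hi.comp_sub_right P).congr hae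
  simp only [sub_mul]
  refine ⟨hi.sub hi', ?_⟩
  rw [integral_sub hi hi', ← integral_congr_ae hae,
    integral_sub_right_eq_self (fun t => r t * k t), sub_self]

theorem LocallyIntegrable.integrable_mul_of_bounded {k r : ℝ → ℂ} {a b C : ℝ}
    (hk : LocallyIntegrable k) (hr : Measurable r) (hb : ∀ t, ‖r t‖ ≤ C)
    (h0 : ∀ t ∉ Icc a b, r t = 0) : Integrable fun t => r t * k t := by
  have h1 : IntegrableOn (fun t => r t * k t) (Icc a b) :=
    (hk.integrableOn_isCompact isCompact_Icc).bdd_mul hr.aestronglyMeasurable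
      (Filter.Eventually.of_forall hb)
  rw [← integrableOn_univ]
  exact h1.of_forall_sdiff_eq_zero MeasurableSet.univ fun t ht => by simp [h0 t ht.2]

/-- The bump and the indicator of `(a, a + P]` differ by `r(t) - r(t - P)`, where `r`, the smooth
step minus the sharp step at `a`, is bounded and supported in `[a, a + 1]`. Such a difference
integrates to zero against a periodic function. -/
theorem integral_periodBump_mul {k : ℝ → ℂ} {P : ℝ} (hP : 0 < P) (a : ℝ)
    (hk : LocallyIntegrable k) (hper : ∀ᵐ t, k (t + P) = k t) :
    ∫ t, periodBump a P t * k t = ∫ t in Ioc a (a + P), k t := by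
  set r : ℝ → ℂ := fun t => (Real.smoothTransition (t - a) : ℂ) - (Ioi a).indicator 1 t with hr
  have hrm : Measurable r :=
    (contDiff_smoothTransition_sub a).continuous.measurable.sub
      (measurable_one.indicator measurableSet_Ioi)
  have hi : Integrable fun t => r t * k t := by
    refine LocallyIntegrable.integrable_mul_of_bounded (a := a) (b := a + 1) (C := 2) hk hrm
      (fun t => ?_) fun t ht => ?_
    · refine (norm_sub_le _ _).trans ?_
      have h1 : ‖(Real.smoothTransition (t - a) : ℂ)‖ ≤ 1 := by
        rw [Complex.norm_real, Real.norm_of_nonneg (Real.smoothTransition.nonneg _)]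
        exact Real.smoothTransition.le_one _
      have h2 : ‖(Ioi a).indicator (1 : ℝ → ℂ) t‖ ≤ 1 :=
        (norm_indicator_le_norm_self _ _).trans (by simp)
      linarith
    · rw [mem_Icc, not_and_or, not_le, not_le] at ht
      rcases ht with ht | ht
      · simp [hr, Real.smoothTransition.zero_of_nonpos (show t - a ≤ 0 by linarith), ht.le]
      · have h2 : a < t := by linarith
        simp [hr, Real.smoothTransition.one_of_one_le (show 1 ≤ t - a by linarith), h2]
  obtain ⟨hi1, hi2⟩ := integral_sub_translate_mul hper hi
  have hki : IntegrableOn k (Ioc a (a + P)) :=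
    (hk.integrableOn_isCompact isCompact_Icc).mono_set Ioc_subset_Icc_self
  have hsplit : ∀ t, periodBump a P t * k t =
      (r t - r (t - P)) * k t + (Ioc a (a + P)).indicator k t := by
    intro t
    by_cases h1 : a < t
    · by_cases h2 : a < t - P
      · have h3 : t ∉ Ioc a (a + P) := fun h => by linarith [h.2]
        simp [hr, periodBump, h1, h2, h3]
      · have h3 : t ∈ Ioc a (a + P) := ⟨h1, by linarith⟩
        simp only [periodBump, hr, indicator_of_mem h3, indicator_of_mem (mem_Ioi.2 h1),
          indicator_of_notMem (notMem_Ioi.2 (not_lt.1 h2)), Pi.one_apply]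
        ring
    · have h2 : ¬ a < t - P := by linarith
      have h3 : t ∉ Ioc a (a + P) := fun h => h1 h.1
      simp [hr, periodBump, h1, h2, h3]
  simp_rw [hsplit]
  rw [integral_add hi1 (hki.integrable_indicator measurableSet_Ioc), hi2, zero_add,
    integral_indicator measurableSet_Ioc]

/-- The derivative of the bump is again of the form `r(t) - r(t - P)`, now with `r` the derivative
of the smooth step. -/
theorem integral_deriv_periodBump_mul {k : ℝ → ℂ} {P : ℝ} (a : ℝ)
    (hk : LocallyIntegrable k) (hper : ∀ᵐ t, k (t + P) = k t) :
    ∫ t, fderiv ℝ (periodBump a P) t 1 * k t = 0 := by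
  set η : ℝ → ℂ := fun t => (Real.smoothTransition (t - a) : ℂ) with hη
  have hηc := contDiff_smoothTransition_sub a
  set r : ℝ → ℂ := fun t => fderiv ℝ η t 1 with hr
  have h0 : ∀ t ∉ Icc a (a + 1), r t = 0 := by
    intro t ht
    rw [mem_Icc, not_and_or, not_le, not_le] at ht
    rcases ht with ht | ht
    · have : η =ᶠ[nhds t] fun _ => 0 := by
        filter_upwards [Iio_mem_nhds ht] with s hs
        simp [hη, Real.smoothTransition.zero_of_nonpos (show s - a ≤ 0 by linarith [mem_Iio.1 hs])]
      simp only [hr, this.fderiv_eq, fderiv_fun_const, Pi.zero_apply,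
        zero_apply]
    · have : η =ᶠ[nhds t] fun _ => 1 := by
        filter_upwards [Ioi_mem_nhds ht] with s hs
        simp [hη, Real.smoothTransition.one_of_one_le (show 1 ≤ s - a by linarith [mem_Ioi.1 hs])]
      simp only [hr, this.fderiv_eq, fderiv_fun_const, Pi.zero_apply,
        zero_apply]
  have hrc : Continuous r := (hηc.continuous_fderiv (by simp)).clm_apply continuous_const
  obtain ⟨C, hC⟩ := isCompact_Icc.exists_bound_of_continuousOn (s := Icc a (a + 1))
    hrc.continuousOn
  have hi : Integrable fun t => r t * k t := by
    refine LocallyIntegrable.integrable_mul_of_bounded (a := a) (b := a + 1) (C := max C 0) hk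
      hrc.measurable (fun t => ?_) h0
    by_cases ht : t ∈ Icc a (a + 1)
    · exact (hC t ht).trans (le_max_left _ _)
    · simp [h0 t ht]
  rw [← (integral_sub_translate_mul hper hi).2]
  congr 1; ext t
  congr 1
  have hd : Differentiable ℝ η := hηc.differentiable (by simp)
  have : periodBump a P = fun t => η t - η (t - P) := rfl
  rw [this, fderiv_fun_sub (hd t) (differentiableAt_comp_sub_const.2 (hd _)),
    fderiv_comp_sub]
  rfl

/-- Integration by parts over one period, for weak derivatives. -/
theorem IsWeakDeriv.integral_period {h h' e : ℝ → ℂ} {P : ℝ} (hP : 0 < P) (a : ℝ)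
    (hw : IsWeakDeriv univ (1 : ℝ) h h') (hper : ∀ᵐ t, h (t + P) = h t)
    (hper' : ∀ᵐ t, h' (t + P) = h' t) (he : ContDiff ℝ ∞ e) (heP : ∀ t, e (t + P) = e t) :
    ∫ t in Ioc a (a + P), h' t * e t = -∫ t in Ioc a (a + P), h t * fderiv ℝ e t 1 := by
  have hl := locallyIntegrableOn_univ.1 hw.1
  have hl' := locallyIntegrableOn_univ.1 hw.2.1
  have hde : Continuous fun t => fderiv ℝ e t 1 :=
    (he.continuous_fderiv (by simp)).clm_apply continuous_const
  have hdP : ∀ t, fderiv ℝ e (t + P) 1 = fderiv ℝ e t 1 := fun t => by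
    have : (fun s => e (s + P)) = e := funext heP
    conv_rhs => rw [← this, fderiv_comp_add_right]
  have lmul : ∀ {g q : ℝ → ℂ}, LocallyIntegrable g → Continuous q →
      LocallyIntegrable fun t => g t * q t := fun {g q} hg hq => by
    rw [locallyIntegrable_iff]
    exact fun K hK => (hg.integrableOn_isCompact hK).mul_continuousOn hq.continuousOn hK
  have k1 := lmul hl' he.continuous
  have k2 := lmul hl hde
  have k3 := lmul hl he.continuous
  rw [← integral_periodBump_mul hP a k1 (by
      filter_upwards [hper'] with t ht; rw [ht, heP]),
    ← integral_periodBump_mul hP a k2 (by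
      filter_upwards [hper] with t ht; rw [ht, hdP])]
  have z := integral_deriv_periodBump_mul (P := P) a k3 (by
      filter_upwards [hper] with t ht; rw [ht, heP])
  have hχ := isTestFunction_periodBump a hP
  -- The bump makes the periodic `e` an admissible test function. In the product rule, the term with
  -- the derivative of the bump integrates to zero by `z`.
  have hψ : IsTestFunction univ fun t => periodBump a P t * e t :=
    ⟨hχ.1.mul he, hχ.2.1.mul_right, subset_univ _⟩
  have key := hw.2.2 _ hψ
  rw [Measure.restrict_univ] at key
  have hd : ∀ t, fderiv ℝ (fun t => periodBump a P t * e t) t 1 =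
      periodBump a P t * fderiv ℝ e t 1 + e t * fderiv ℝ (periodBump a P) t 1 := fun t => by
    rw [fderiv_fun_mul (hχ.1.differentiable (by simp) t) (he.differentiable (by simp) t)]
    simp
  have i2 : Integrable fun t => periodBump a P t * (h t * fderiv ℝ e t 1) := by
    have := hχ.integrableOn_mul MeasurableSet.univ (locallyIntegrableOn_univ.2 k2)
    rw [integrableOn_univ] at this
    simpa only [mul_comm] using this
  have i3 : Integrable fun t => fderiv ℝ (periodBump a P) t 1 * (h t * e t) := by
    have := hχ.integrableOn_mul_fderiv MeasurableSet.univ (locallyIntegrableOn_univ.2 k3) 1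
    rw [integrableOn_univ] at this
    simpa only [mul_comm] using this
  have : ∫ t, h t * fderiv ℝ (fun t => periodBump a P t * e t) t 1 =
      ∫ t, periodBump a P t * (h t * fderiv ℝ e t 1) := by
    rw [← add_zero (∫ t, periodBump a P t * (h t * fderiv ℝ e t 1)), ← z, ← integral_add i2 i3]
    congr 1; ext t
    rw [hd]; ring
  rw [← this, key, neg_neg]
  congr 1; ext t; ring

end Periodic

section PeriodicFiber

theorem ae_marginal_periodic {X : Type*} [MeasureSpace X] [SigmaFinite (volume : Measure X)]
    {Ω : Set X} {f : ℝ × X → ℂ} {P : ℝ}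
    (hper : ∀ᵐ p ∂volume.restrict (univ ×ˢ Ω), f (p.1 + P, p.2) = f p) (φ : X → ℂ) :
    ∀ᵐ t, (∫ y in Ω, f (t + P, y) * φ y) = ∫ y in Ω, f (t, y) * φ y := by
  rw [volume_restrict_prod, Measure.restrict_univ] at hper
  filter_upwards [Measure.ae_ae_of_ae_prod hper] with t ht
  refine integral_congr_ae ?_
  filter_upwards [ht] with y hy
  rw [hy]

variable {X : Type*} [NormedAddCommGroup X] [NormedSpace ℝ X] [MeasureSpace X] [BorelSpace X]
  [SecondCountableTopology X] [SigmaFinite (volume : Measure X)]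

variable [FiniteDimensional ℝ X]

/-- Integration by parts in the first variable over one period. -/
theorem IsWeakDeriv.integral_period_fiber {Ω : Set X} {f g : ℝ × X → ℂ} {e : ℝ → ℂ} {P : ℝ}
    (hΩ : IsOpen Ω) (hP : 0 < P) (a : ℝ) (h : IsWeakDeriv (univ ×ˢ Ω) ((1 : ℝ), (0 : X)) f g)
    (hf : ∀ᵐ p ∂volume.restrict (univ ×ˢ Ω), f (p.1 + P, p.2) = f p)
    (hg : ∀ᵐ p ∂volume.restrict (univ ×ˢ Ω), g (p.1 + P, p.2) = g p)
    (he : ContDiff ℝ ∞ e) (heP : ∀ t, e (t + P) = e t) :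
    ∀ᵐ y ∂volume.restrict Ω, ∫ t in Ioc a (a + P), g (t, y) * e t =
      -∫ t in Ioc a (a + P), f (t, y) * fderiv ℝ e t 1 := by
  have : LocallyCompactSpace X := have := FiniteDimensional.proper ℝ X; inferInstance
  have hde : Continuous fun t => fderiv ℝ e t 1 :=
    (he.continuous_fderiv (by simp)).clm_apply continuous_const
  have hm := hΩ.measurableSet
  have l1 := LocallyIntegrableOn.integral_fiber hΩ h.2.1 he.continuous a (a + P)
  have l2 := LocallyIntegrableOn.integral_fiber hΩ h.1 hde a (a + P)
  -- Testing in `y` reduces the claim to one dimension: the marginal of `g` against `φ` is the weak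
  -- derivative of the marginal of `f`, and both are periodic.
  have key := ae_eq_zero_of_forall_isTestFunction hΩ (l1.add l2) fun φ hφ => by
    have h0 : ∀ y ∉ tsupport φ, φ y = 0 := fun y hy => image_eq_zero_of_notMem_tsupport hy
    simp only [Pi.add_apply, add_mul]
    rw [integral_add (hφ.integrableOn_mul hm l1) (hφ.integrableOn_mul hm l2),
      integral_fiber_mul hm h.2.1 hφ.continuous hφ.2.1 hφ.2.2 h0 he.continuous,
      integral_fiber_mul hm h.1 hφ.continuous hφ.2.1 hφ.2.2 h0 hde,
      IsWeakDeriv.integral_period (h := fun t => ∫ y in Ω, f (t, y) * φ y) hP a ?_ (ae_marginal_periodic hf φ)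
        (ae_marginal_periodic hg φ) he heP, neg_add_cancel]
    refine ⟨locallyIntegrableOn_univ.2
      (LocallyIntegrableOn.locallyIntegrable_marginal hm h.1 hφ.continuous hφ.2.1 hφ.2.2 h0),
      locallyIntegrableOn_univ.2
      (LocallyIntegrableOn.locallyIntegrable_marginal hm h.2.1 hφ.continuous hφ.2.1 hφ.2.2 h0),
      fun χ hχ => ?_⟩
    rw [Measure.restrict_univ, integral_mul_marginal hm h.1 hφ.continuous hφ.2.1 hφ.2.2 h0
        (hχ.continuous_fderiv 1) (hχ.2.1.fderiv_apply ℝ 1),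
      integral_mul_marginal hm h.2.1 hφ.continuous hφ.2.1 hφ.2.2 h0 hχ.continuous hχ.2.1]
    have := h.2.2 _ (hχ.prod_mul hφ)
    simpa only [fderiv_prod_mul_apply hχ.1 hφ.1, map_zero, mul_zero, zero_add] using this
  filter_upwards [key] with y hy
  exact eq_neg_of_add_eq_zero_left hy

end PeriodicFiber

/-! ### Geometry of the periodic strip -/

section Geometry

variable {Λ H : ℝ} {ζ : ℝ → ℝ}

theorem isOpen_stripDomain (hζ : Continuous ζ) : IsOpen (stripDomain ζ H) :=
  (isOpen_lt (hζ.comp continuous_fst) continuous_snd).inter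
    (isOpen_lt continuous_snd continuous_const)

theorem measurableSet_cellDomain (hζ : Continuous ζ) : MeasurableSet (cellDomain Λ ζ H) :=
  (isOpen_stripDomain hζ).measurableSet.inter (measurable_fst measurableSet_Ioc)

theorem add_mem_stripDomain_iff (hζ : Function.Periodic ζ Λ) (j : ℤ) (x : ℝ × ℝ) :
    x + (Λ * (j : ℝ), 0) ∈ stripDomain ζ H ↔ x ∈ stripDomain ζ H := by
  have : ζ (x.1 + Λ * j) = ζ x.1 := by rw [mul_comm]; exact hζ.int_mul j x.1
  simp [stripDomain, this]

theorem add_mem_cylinder_iff (hζ : Function.Periodic ζ Λ) (j : ℤ) (p : ℝ × (ℝ × ℝ)) :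
    p + (0, (Λ * (j : ℝ), 0)) ∈ (univ : Set ℝ) ×ˢ stripDomain ζ H ↔
      p ∈ (univ : Set ℝ) ×ˢ stripDomain ζ H := by
  simp only [mem_prod, mem_univ, true_and, Prod.snd_add]
  exact add_mem_stripDomain_iff hζ j p.2

theorem add_fst_mem_cylinder_iff (P : ℝ) (p : ℝ × (ℝ × ℝ)) :
    p + (P, 0) ∈ (univ : Set ℝ) ×ˢ stripDomain ζ H ↔
      p ∈ (univ : Set ℝ) ×ˢ stripDomain ζ H := by
  simp

theorem sub_cellIndex_mem (hΛ : 0 < Λ) (t : ℝ) :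
    t - Λ * cellIndex Λ t ∈ Ioc (-(Λ / 2)) (Λ / 2) := by
  have h1 := Int.le_ceil (t / Λ - 1 / 2)
  have h2 := Int.ceil_lt_add_one (t / Λ - 1 / 2)
  have e : t = t / Λ * Λ := by field_simp
  rw [cellIndex]
  constructor <;> nlinarith

/-- `J` need only contain the indices of the cells that meet `S`: all of `ℤ` for the whole strip,
`|j| ≥ L` for the tail. -/
theorem stripDomain_subset_iUnion (hΛ : 0 < Λ) (hζ : Function.Periodic ζ Λ) {J : Set ℤ}
    {S : Set (ℝ × ℝ)} (hS : S ⊆ stripDomain ζ H)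
    (hJ : ∀ j : ℤ, ∀ y ∈ cellDomain Λ ζ H, y + (Λ * (j : ℝ), 0) ∈ S → j ∈ J) :
    S ⊆ ⋃ j : J, (fun x : ℝ × ℝ => x + (Λ * ((j : ℤ) : ℝ), 0)) '' cellDomain Λ ζ H := by
  intro x hx
  have he : x + (Λ * ((-cellIndex Λ x.1 : ℤ) : ℝ), 0) + (Λ * (cellIndex Λ x.1 : ℝ), 0) = x := by
    ext <;> simp
  have hy : x + (Λ * ((-cellIndex Λ x.1 : ℤ) : ℝ), 0) ∈ cellDomain Λ ζ H := by
    refine ⟨(add_mem_stripDomain_iff hζ _ x).2 (hS hx), ?_⟩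
    have := sub_cellIndex_mem hΛ x.1
    simpa [sub_eq_add_neg] using this
  exact mem_iUnion.2 ⟨⟨cellIndex Λ x.1, hJ _ _ hy (he.symm ▸ hx)⟩, _, hy, he⟩

theorem dualCell_eq (Λ : ℝ) : dualCell Λ =
    Ioc (-(Real.pi / Λ)) (-(Real.pi / Λ) + 2 * Real.pi / Λ) := by
  rw [dualCell]; congr 1; ring

theorem measurableSet_truncDomain (hζ : Continuous ζ) (L : ℕ) :
    MeasurableSet (truncDomain Λ ζ H L) :=
  MeasurableSet.biUnion (to_countable _) fun j _ =>
    (MeasurableEquiv.addRight ((Λ * (j : ℝ), 0) : ℝ × ℝ)).measurableEmbedding.measurableSet_image'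
      (measurableSet_cellDomain hζ)

end Geometry

/-! ### Bloch coefficients -/

section BlochCoeff

/-- The value of the inverse Bloch transform of `f` on the `j`-th translate of the point `y`:
a Fourier coefficient of `f (·, y)`. -/
def blochCoeff (Λ : ℝ) (f : ℝ × (ℝ × ℝ) → ℂ) (j : ℤ) (y : ℝ × ℝ) : ℂ :=
  (Real.sqrt (Λ / (2 * Real.pi)) : ℂ) *
    ∫ α in dualCell Λ, f (α, y) * Complex.exp (Complex.I * α * Λ * j)

theorem contDiff_blochExp (Λ : ℝ) (j : ℤ) :
    ContDiff ℝ ∞ fun α : ℝ => Complex.exp (Complex.I * α * Λ * j) :=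
  Complex.contDiff_exp.comp
    (((contDiff_const.mul Complex.ofRealCLM.contDiff).mul contDiff_const).mul contDiff_const)

theorem fderiv_blochExp (Λ : ℝ) (j : ℤ) (t : ℝ) :
    fderiv ℝ (fun α : ℝ => Complex.exp (Complex.I * α * Λ * j)) t 1 =
      (Complex.I * Λ * j) * Complex.exp (Complex.I * t * Λ * j) := by
  have h1 : HasDerivAt (fun α : ℝ => Complex.I * α * Λ * j) (Complex.I * Λ * j) t := by
    have := ((((hasDerivAt_id t).ofReal_comp).const_mul Complex.I).mul_const (Λ : ℂ)).mul_const
      (j : ℂ)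
    simpa using this
  rw [fderiv_apply_one_eq_deriv, h1.cexp.deriv, mul_comm]

theorem blochExp_periodic {Λ : ℝ} (hΛ : 0 < Λ) (j : ℤ) (t : ℝ) :
    Complex.exp (Complex.I * ((t + 2 * Real.pi / Λ : ℝ) : ℂ) * Λ * j) =
      Complex.exp (Complex.I * t * Λ * j) := by
  have hΛ' : (Λ : ℂ) ≠ 0 := by exact_mod_cast hΛ.ne'
  have : Complex.I * ((t + 2 * Real.pi / Λ : ℝ) : ℂ) * Λ * j =
      Complex.I * t * Λ * j + j * (2 * Real.pi * Complex.I) := by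
    push_cast; field_simp
  rw [this, Complex.exp_add, Complex.exp_int_mul_two_pi_mul_I, mul_one]

/-- The kernel `e^{iαΛj}` is the conjugate of the character of index `-j`, hence the sign. The
Fourier coefficient carries the factor `Λ/(2π)`, the Bloch coefficient only its square root, hence
`2π/Λ` after squaring. -/
theorem norm_sq_blochCoeff_eq {Λ : ℝ} (hΛ : 0 < Λ)
    (hab : -(Real.pi / Λ) < Real.pi / Λ) (g : ℝ → ℂ) (j : ℤ) :
    ‖(Real.sqrt (Λ / (2 * Real.pi)) : ℂ) *
      ∫ α in dualCell Λ, g α * Complex.exp (Complex.I * α * Λ * j)‖ ^ 2 =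
      (2 * Real.pi / Λ) * ‖fourierCoeffOn hab g (-j)‖ ^ 2 := by
  have hpi := Real.pi_pos
  have hΛ' : (Λ : ℂ) ≠ 0 := by exact_mod_cast hΛ.ne'
  have hpi' : (Real.pi : ℂ) ≠ 0 := by exact_mod_cast hpi.ne'
  rw [fourierCoeffOn_eq_integral, intervalIntegral.integral_of_le hab.le, neg_neg, dualCell]
  have : ∀ α : ℝ, fourier j (α : AddCircle (Real.pi / Λ - -(Real.pi / Λ))) • g α =
      g α * Complex.exp (Complex.I * α * Λ * j) := by
    intro α
    rw [fourier_coe_apply, smul_eq_mul, mul_comm]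
    congr 2
    push_cast; field_simp; ring
  simp_rw [this]
  rw [norm_mul, norm_smul, mul_pow, mul_pow, Complex.norm_real,
    Real.norm_of_nonneg (Real.sqrt_nonneg _), Real.sq_sqrt (by positivity), ← mul_assoc]
  congr 1
  rw [Real.norm_eq_abs, sq_abs]
  field_simp
  ring

/-- Bessel's inequality. -/
theorem tsum_enorm_sq_le {Λ : ℝ} (hΛ : 0 < Λ) {g : ℝ → ℂ}
    (hg : AEStronglyMeasurable g (volume.restrict (dualCell Λ))) :
    ∑' j : ℤ, ‖(Real.sqrt (Λ / (2 * Real.pi)) : ℂ) *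
      ∫ α in dualCell Λ, g α * Complex.exp (Complex.I * α * Λ * j)‖ₑ ^ 2 ≤
      ∫⁻ α in dualCell Λ, ‖g α‖ₑ ^ 2 := by
  -- If the right side is infinite there is nothing to prove; otherwise `g` is in `L²` and
  -- Parseval's identity applies, reindexed by `j ↦ -j`.
  by_cases htop : ∫⁻ α in dualCell Λ, ‖g α‖ₑ ^ 2 = ⊤
  · rw [htop]; exact le_top
  have hpi := Real.pi_pos
  have hab : -(Real.pi / Λ) < Real.pi / Λ := by
    have : 0 < Real.pi / Λ := by positivity
    linarith
  have hL2 : MemLp g 2 (volume.restrict (dualCell Λ)) := by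
    refine ⟨hg, ?_⟩
    rw [eLpNorm_lt_top_iff_lintegral_rpow_enorm_lt_top (by simp) (by simp)]
    simpa using lt_top_iff_ne_top.2 htop
  have hs := (hasSum_sq_fourierCoeffOn hab hL2).mul_left (2 * Real.pi / Λ)
  rw [← (Equiv.neg ℤ).hasSum_iff] at hs
  simp only [Function.comp_def, Equiv.neg_apply, ← norm_sq_blochCoeff_eq hΛ hab] at hs
  have hb : (2 * Real.pi / Λ) * ((Real.pi / Λ - -(Real.pi / Λ))⁻¹ •
      ∫ x in (-(Real.pi / Λ))..(Real.pi / Λ), ‖g x‖ ^ 2) = ∫ x in dualCell Λ, ‖g x‖ ^ 2 := by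
    rw [smul_eq_mul, intervalIntegral.integral_of_le hab.le, dualCell]
    field_simp
    ring
  rw [hb] at hs
  have he : ∀ z : ℂ, ‖z‖ₑ ^ 2 = ENNReal.ofReal (‖z‖ ^ 2) := fun z => by
    rw [ENNReal.ofReal_pow (norm_nonneg _), ofReal_norm]
  simp_rw [he]
  rw [← ENNReal.ofReal_tsum_of_nonneg (fun _ => by positivity) hs.summable, hs.tsum_eq,
    ofReal_integral_eq_lintegral_ofReal (hL2.integrable_norm_pow (p := 2) two_ne_zero)
      (Filter.Eventually.of_forall fun _ => by positivity)]

theorem lintegral_tsum_blochCoeff_le {Λ : ℝ} (hΛ : 0 < Λ) {f : ℝ × (ℝ × ℝ) → ℂ}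
    {S : Set (ℝ × ℝ)} (hf : AEStronglyMeasurable f (volume.restrict (dualCell Λ ×ˢ S))) :
    ∫⁻ y in S, ∑' j : ℤ, ‖blochCoeff Λ f j y‖ₑ ^ 2 ≤ ∫⁻ p in dualCell Λ ×ˢ S, ‖f p‖ₑ ^ 2 := by
  rw [volume_restrict_prod] at hf ⊢
  rw [lintegral_prod_symm _ (hf.enorm.pow_const 2)]
  refine lintegral_mono_ae ?_
  filter_upwards [hf.prod_swap.prodMk_left] with y hy
  exact tsum_enorm_sq_le hΛ hy

/-- Each translate is moved back to `S`, the sum over `J` is enlarged to `ℤ`, and Bessel's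
inequality is applied for a.e. `y`. The factor `c` carries the decay. -/
theorem lintegral_iUnion_translates_le {Λ : ℝ} (hΛ : 0 < Λ) {f : ℝ × (ℝ × ℝ) → ℂ}
    {g : ℝ × ℝ → ℂ} {S T : Set (ℝ × ℝ)} {J : Set ℤ} {c : ENNReal}
    (hf : AEStronglyMeasurable f (volume.restrict (dualCell Λ ×ˢ S)))
    (hfm : ∀ j, AEStronglyMeasurable (blochCoeff Λ f j) (volume.restrict S))
    (hT : T ⊆ ⋃ j : J, (fun x : ℝ × ℝ => x + (Λ * ((j : ℤ) : ℝ), 0)) '' S)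
    (hg : ∀ j ∈ J, ∀ᵐ y ∂volume.restrict S,
      ‖g (y + (Λ * ((j : ℤ) : ℝ), 0))‖ₑ ≤ c * ‖blochCoeff Λ f j y‖ₑ) :
    ∫⁻ x in T, ‖g x‖ₑ ^ 2 ≤ c ^ 2 * ∫⁻ p in dualCell Λ ×ˢ S, ‖f p‖ₑ ^ 2 := by
  have htr : ∀ a : ℝ × ℝ, ∫⁻ x in (fun x => x + a) '' S, ‖g x‖ₑ ^ 2 =
      ∫⁻ x in S, ‖g (x + a)‖ₑ ^ 2 := fun a =>
    ((measurePreserving_add_right volume a).setLIntegral_comp_emb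
      (MeasurableEquiv.addRight a).measurableEmbedding (fun x => ‖g x‖ₑ ^ 2) S).symm
  calc ∫⁻ x in T, ‖g x‖ₑ ^ 2
      ≤ ∑' j : J, ∫⁻ x in (fun x : ℝ × ℝ => x + (Λ * ((j : ℤ) : ℝ), 0)) '' S, ‖g x‖ₑ ^ 2 :=
        (lintegral_mono_set hT).trans (lintegral_iUnion_le _ _)
    _ ≤ ∑' j : J, c ^ 2 * ∫⁻ y in S, ‖blochCoeff Λ f j y‖ₑ ^ 2 := by
        refine ENNReal.tsum_le_tsum fun j => ?_
        rw [htr, ← lintegral_const_mul'' _ ((hfm j).enorm.pow_const 2)]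
        refine lintegral_mono_ae ?_
        filter_upwards [hg j j.2] with y hy
        rw [← mul_pow]
        gcongr
    _ ≤ ∑' j : ℤ, c ^ 2 * ∫⁻ y in S, ‖blochCoeff Λ f j y‖ₑ ^ 2 :=
        ENNReal.tsum_comp_le_tsum_of_injective Subtype.val_injective _
    _ = c ^ 2 * ∫⁻ y in S, ∑' j : ℤ, ‖blochCoeff Λ f j y‖ₑ ^ 2 := by
        rw [ENNReal.tsum_mul_left, lintegral_tsum fun j => (hfm j).enorm.pow_const 2]
    _ ≤ _ := by
        gcongr
        exact lintegral_tsum_blochCoeff_le hΛ hf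

theorem IsWeakDeriv.blochCoeff {Λ : ℝ} {Ω : Set (ℝ × ℝ)} {v : ℝ × ℝ}
    {f g : ℝ × (ℝ × ℝ) → ℂ} (hΩ : IsOpen Ω)
    (h : IsWeakDeriv (univ ×ˢ Ω) ((0 : ℝ), v) f g) (j : ℤ) :
    IsWeakDeriv Ω v (blochCoeff Λ f j) (blochCoeff Λ g j) :=
  (IsWeakDeriv.integral_fiber hΩ h (contDiff_blochExp Λ j).continuous _ _).const_mul _

/-- Integration by parts over the dual cell: `f`, `g` and the kernel share the period `2π/Λ`, and
differentiating the kernel gives `iΛj`. -/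
theorem blochCoeff_weakDeriv {Λ : ℝ} (hΛ : 0 < Λ) {Ω : Set (ℝ × ℝ)}
    {f g : ℝ × (ℝ × ℝ) → ℂ} (hΩ : IsOpen Ω)
    (h : IsWeakDeriv (univ ×ˢ Ω) ((1 : ℝ), (0 : ℝ × ℝ)) f g)
    (hf : ∀ᵐ p ∂volume.restrict (univ ×ˢ Ω), f (p.1 + 2 * Real.pi / Λ, p.2) = f p)
    (hg : ∀ᵐ p ∂volume.restrict (univ ×ˢ Ω), g (p.1 + 2 * Real.pi / Λ, p.2) = g p) (j : ℤ) :
    ∀ᵐ y ∂volume.restrict Ω, blochCoeff Λ g j y = -(Complex.I * Λ * j) * blochCoeff Λ f j y := by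
  have hpi := Real.pi_pos
  filter_upwards [IsWeakDeriv.integral_period_fiber hΩ (by positivity) (-(Real.pi / Λ)) h hf hg
    (contDiff_blochExp Λ j) (blochExp_periodic hΛ j)] with y hy
  simp_rw [blochCoeff, dualCell_eq]
  rw [hy]
  simp_rw [fderiv_blochExp, mul_left_comm _ (Complex.I * (Λ : ℂ) * j)]
  rw [integral_const_mul]
  ring

end BlochCoeff

/-! ### Elements of the Bloch-Sobolev spaces -/

instance isAddHaarMeasure_volume_cylinder :
    (volume : Measure (ℝ × (ℝ × ℝ))).IsAddHaarMeasure :=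
  inferInstanceAs ((volume : Measure ℝ).prod (volume : Measure (ℝ × ℝ))).IsAddHaarMeasure

section BlochSobolev

variable {Λ H : ℝ} {ζ : ℝ → ℝ} {n : ℕ} {w : ℝ × (ℝ × ℝ) → ℂ}

theorem alphaDeriv_zero : alphaDeriv ζ H 0 w = w := rfl

theorem alphaDeriv_succ (m : ℕ) : alphaDeriv ζ H (m + 1) w =
    weakDeriv (univ ×ˢ stripDomain ζ H) (1, 0) (alphaDeriv ζ H m w) :=
  Function.iterate_succ_apply' _ _ _

theorem MemBlochSobolev.isWeakDeriv_alpha (hw : MemBlochSobolev Λ ζ H n w) {m : ℕ} (hm : m < n) :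
    IsWeakDeriv (univ ×ˢ stripDomain ζ H) ((1 : ℝ), (0 : ℝ × ℝ)) (alphaDeriv ζ H m w)
      (alphaDeriv ζ H (m + 1) w) := by
  rw [alphaDeriv_succ]; exact (hw.hasAlphaDeriv m hm).isWeakDeriv

theorem MemBlochSobolev.isWeakDeriv_mixed (hw : MemBlochSobolev Λ ζ H n w) {m : ℕ} (hm : m ≤ n)
    (i : Fin 2) : IsWeakDeriv (univ ×ˢ stripDomain ζ H) ((0 : ℝ), basisVec i)
      (alphaDeriv ζ H m w) (mixedDeriv ζ H m i w) :=
  (hw.hasMixedDeriv m hm i).isWeakDeriv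

/-- The shifted derivative is a weak derivative of the shifted function, which is the function
itself; uniqueness concludes. -/
theorem MemBlochSobolev.periodic_alphaDeriv (hw : MemBlochSobolev Λ ζ H n w)
    (hζ : Continuous ζ) : ∀ {m : ℕ}, m ≤ n →
      ∀ᵐ p ∂volume.restrict (univ ×ˢ stripDomain ζ H),
        alphaDeriv ζ H m w (p.1 + 2 * Real.pi / Λ, p.2) = alphaDeriv ζ H m w p
  | 0, _ => hw.periodic
  | m + 1, hm => by
    have hD : IsOpen ((univ : Set ℝ) ×ˢ stripDomain ζ H) := isOpen_univ.prod (isOpen_stripDomain hζ)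
    have h := hw.isWeakDeriv_alpha (Nat.lt_of_succ_le hm)
    have h2 := h.comp_add (add_fst_mem_cylinder_iff (ζ := ζ) (H := H) (2 * Real.pi / Λ))
    have ih := hw.periodic_alphaDeriv hζ (Nat.le_of_succ_le hm)
    have hadd : ∀ p : ℝ × (ℝ × ℝ), p + (2 * Real.pi / Λ, 0) = (p.1 + 2 * Real.pi / Λ, p.2) :=
      fun p => by ext <;> simp
    simp only [hadd] at h2
    exact (h2.congr ih Filter.EventuallyEq.rfl).unique hD h

theorem MemBlochSobolev.blochCoeff_alphaDeriv (hw : MemBlochSobolev Λ ζ H n w) (hΛ : 0 < Λ)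
    (hζ : Continuous ζ) (j : ℤ) : ∀ {m : ℕ}, m ≤ n →
      ∀ᵐ y ∂volume.restrict (stripDomain ζ H), blochCoeff Λ (alphaDeriv ζ H m w) j y =
        (-(Complex.I * Λ * j)) ^ m * blochCoeff Λ w j y
  | 0, _ => by simp [alphaDeriv_zero]
  | m + 1, hm => by
    filter_upwards [hw.blochCoeff_alphaDeriv hΛ hζ j (Nat.le_of_succ_le hm),
      blochCoeff_weakDeriv hΛ (isOpen_stripDomain hζ) (hw.isWeakDeriv_alpha (Nat.lt_of_succ_le hm))
        (hw.periodic_alphaDeriv hζ (Nat.le_of_succ_le hm)) (hw.periodic_alphaDeriv hζ hm) j]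
      with y h1 h2
    rw [h2, h1]; ring

/-- No interchange of `∂_α` and `∂_{x_i}` is needed: both sides are weak `x_i`-derivatives of the
`j`-th coefficient of `∂_α^m w`. -/
theorem MemBlochSobolev.blochCoeff_mixedDeriv (hw : MemBlochSobolev Λ ζ H n w) (hΛ : 0 < Λ)
    (hζ : Continuous ζ) (j : ℤ) {m : ℕ} (hm : m ≤ n) (i : Fin 2) :
    ∀ᵐ y ∂volume.restrict (stripDomain ζ H), blochCoeff Λ (mixedDeriv ζ H m i w) j y =
      (-(Complex.I * Λ * j)) ^ m * blochCoeff Λ (mixedDeriv ζ H 0 i w) j y := by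
  have hΩ := isOpen_stripDomain (H := H) hζ
  have h1 := (hw.isWeakDeriv_mixed hm i).blochCoeff (Λ := Λ) hΩ j
  have h2 := ((hw.isWeakDeriv_mixed (Nat.zero_le n) i).blochCoeff (Λ := Λ) hΩ j).const_mul
    ((-(Complex.I * Λ * j)) ^ m)
  exact (h1.congr (hw.blochCoeff_alphaDeriv hΛ hζ j hm) Filter.EventuallyEq.rfl).unique hΩ h2

theorem MemBlochSobolev.quasiPeriodic_int (hw : MemBlochSobolev Λ ζ H n w)
    (hper : Function.Periodic ζ Λ) (j : ℤ) :
    ∀ᵐ p ∂volume.restrict (univ ×ˢ stripDomain ζ H),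
      w (p.1, p.2 + (Λ * (j : ℝ), 0)) = Complex.exp (Complex.I * p.1 * Λ * j) * w p := by
  have shift : ∀ j : ℤ, ∀ᵐ p ∂volume.restrict ((univ : Set ℝ) ×ˢ stripDomain ζ H),
      w (p.1, p.2 + (Λ * ((j + 1 : ℤ) : ℝ), 0)) =
        Complex.exp (Complex.I * p.1 * Λ) * w (p.1, p.2 + (Λ * (j : ℝ), 0)) := fun j => by
    have := (measurePreserving_add_restrict
      (add_mem_cylinder_iff (H := H) hper j)).quasiMeasurePreserving.ae hw.quasiPeriodic
    filter_upwards [this] with p hp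
    have e1 : p.2 + (Λ * ((j + 1 : ℤ) : ℝ), 0) = p.2 + (Λ * (j : ℝ), 0) + (Λ, 0) := by
      ext <;> simp; ring
    have e2 : p + (0, (Λ * (j : ℝ), 0)) = (p.1, p.2 + (Λ * (j : ℝ), 0)) := by ext <;> simp
    rw [e2] at hp
    rw [e1]
    exact hp
  induction j using Int.induction_on with
  | zero =>
    refine Filter.Eventually.of_forall fun p => ?_
    have : p.2 + (Λ * ((0 : ℤ) : ℝ), 0) = p.2 := by ext <;> simp
    rw [this]; simp
  | succ j ih =>
    filter_upwards [ih, shift j] with p h1 h2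
    rw [h2, h1, ← mul_assoc, ← Complex.exp_add]
    congr 2; push_cast; ring
  | pred j ih =>
    filter_upwards [ih, shift (-(j : ℤ) - 1)] with p h1 h2
    rw [sub_add_cancel, h1] at h2
    rw [← mul_right_inj' (Complex.exp_ne_zero (Complex.I * p.1 * Λ)), ← h2, ← mul_assoc,
      ← Complex.exp_add]
    congr 2; push_cast; ring

/-- The quasi-periodicity factor `e^{iαΛj}` is exactly the kernel of the `j`-th coefficient. -/
theorem MemBlochSobolev.blochCoeff_translate (hw : MemBlochSobolev Λ ζ H n w)
    (hper : Function.Periodic ζ Λ) (j : ℤ) :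
    ∀ᵐ y ∂volume.restrict (stripDomain ζ H),
      blochCoeff Λ w 0 (y + (Λ * (j : ℝ), 0)) = blochCoeff Λ w j y := by
  have h := hw.quasiPeriodic_int hper j
  rw [volume_restrict_prod, Measure.restrict_univ] at h
  have h2 := Measure.ae_ae_of_ae_prod
    (Measure.measurePreserving_swap.quasiMeasurePreserving.ae h)
  filter_upwards [h2] with y hy
  rw [blochCoeff, blochCoeff]
  congr 1
  refine integral_congr_ae ?_
  filter_upwards [ae_restrict_of_ae hy] with α hα
  simp only [Prod.swap_prod_mk] at hα
  rw [hα]; simp [mul_comm]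

/-- One formula replaces the definition by cells, so the weak gradient can be taken across cell
interfaces. -/
theorem MemBlochSobolev.invBloch_ae_eq (hw : MemBlochSobolev Λ ζ H n w)
    (hper : Function.Periodic ζ Λ) :
    invBloch Λ w =ᵐ[volume.restrict (stripDomain ζ H)] blochCoeff Λ w 0 := by
  have h : ∀ j : ℤ, ∀ᵐ y ∂volume.restrict (stripDomain ζ H),
      blochCoeff Λ w 0 y = blochCoeff Λ w j (y - (Λ * (j : ℝ), 0)) := fun j => by
    have := (measurePreserving_add_restrict
      (add_mem_stripDomain_iff (H := H) hper (-j))).quasiMeasurePreserving.ae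
        (hw.blochCoeff_translate hper j)
    filter_upwards [this] with y hy
    have e1 : y + (Λ * ((-j : ℤ) : ℝ), 0) = y - (Λ * (j : ℝ), 0) := by
      ext <;> simp [sub_eq_add_neg]
    rwa [e1, sub_add_cancel] at hy
  -- There are countably many `j`, so one null set serves for all of them and `j` may depend on `y`.
  filter_upwards [ae_all_iff.2 h] with y hy
  rw [hy (cellIndex Λ y.1)]
  rfl

theorem MemBlochSobolev.isWeakDeriv_invBloch (hw : MemBlochSobolev Λ ζ H n w)
    (hζ : Continuous ζ) (hper : Function.Periodic ζ Λ) (i : Fin 2) :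
    IsWeakDeriv (stripDomain ζ H) (basisVec i) (invBloch Λ w)
      (blochCoeff Λ (mixedDeriv ζ H 0 i w) 0) :=
  ((hw.isWeakDeriv_mixed (Nat.zero_le n) i).blochCoeff (isOpen_stripDomain hζ) 0).congr
    (hw.invBloch_ae_eq hper).symm Filter.EventuallyEq.rfl

theorem MemBlochSobolev.hasWeakDeriv_invBloch (hw : MemBlochSobolev Λ ζ H n w)
    (hζ : Continuous ζ) (hper : Function.Periodic ζ Λ) (i : Fin 2) :
    HasWeakDeriv (stripDomain ζ H) (basisVec i) (invBloch Λ w) :=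
  ⟨_, hw.isWeakDeriv_invBloch hζ hper i⟩

theorem MemBlochSobolev.invBloch_translate (hw : MemBlochSobolev Λ ζ H n w)
    (hper : Function.Periodic ζ Λ) (j : ℤ) :
    ∀ᵐ y ∂volume.restrict (stripDomain ζ H),
      invBloch Λ w (y + (Λ * (j : ℝ), 0)) = blochCoeff Λ w j y := by
  filter_upwards [hw.blochCoeff_translate hper j, (measurePreserving_add_restrict
    (add_mem_stripDomain_iff (H := H) hper j)).quasiMeasurePreserving.ae
      (hw.invBloch_ae_eq hper)] with y h1 h2
  rw [h2, h1]

theorem MemBlochSobolev.weakDeriv_invBloch_translate (hw : MemBlochSobolev Λ ζ H n w)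
    (hζ : Continuous ζ) (hper : Function.Periodic ζ Λ) (i : Fin 2) (j : ℤ) :
    ∀ᵐ y ∂volume.restrict (stripDomain ζ H),
      weakDeriv (stripDomain ζ H) (basisVec i) (invBloch Λ w) (y + (Λ * (j : ℝ), 0)) =
        blochCoeff Λ (mixedDeriv ζ H 0 i w) j y := by
  have hΩ := isOpen_stripDomain (H := H) hζ
  have h1 := (hw.hasWeakDeriv_invBloch hζ hper i).isWeakDeriv.comp_add
    (add_mem_stripDomain_iff (H := H) hper j)
  exact (h1.congr (hw.invBloch_translate hper j) Filter.EventuallyEq.rfl).unique hΩ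
    ((hw.isWeakDeriv_mixed (Nat.zero_le n) i).blochCoeff hΩ j)

/-- `g` on the `j`-th translate of the cell is, up to the factor `(-iΛj)^m`, the `j`-th Bloch
coefficient of `f`. -/
def IsBlochPair (Λ : ℝ) (Ω : Set (ℝ × ℝ)) (m : ℕ) (f : ℝ × (ℝ × ℝ) → ℂ) (g : ℝ × ℝ → ℂ) : Prop :=
  LocallyIntegrableOn f (univ ×ˢ Ω) ∧ ∀ j : ℤ, ∀ᵐ y ∂volume.restrict Ω,
    blochCoeff Λ f j y = (-(Complex.I * Λ * j)) ^ m * g (y + (Λ * (j : ℝ), 0))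

theorem MemBlochSobolev.isBlochPair (hw : MemBlochSobolev Λ ζ H n w) (hΛ : 0 < Λ)
    (hζ : Continuous ζ) (hper : Function.Periodic ζ Λ) {m : ℕ} (hm : m ≤ n) :
    IsBlochPair Λ (stripDomain ζ H) m (alphaDeriv ζ H m w) (invBloch Λ w) := by
  refine ⟨(hw.isWeakDeriv_mixed hm 0).1, fun j => ?_⟩
  filter_upwards [hw.invBloch_translate hper j, hw.blochCoeff_alphaDeriv hΛ hζ j hm] with y h1 h2
  rw [h1, h2]

theorem MemBlochSobolev.isBlochPair_weakDeriv (hw : MemBlochSobolev Λ ζ H n w) (hΛ : 0 < Λ)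
    (hζ : Continuous ζ) (hper : Function.Periodic ζ Λ) {m : ℕ} (hm : m ≤ n) (i : Fin 2) :
    IsBlochPair Λ (stripDomain ζ H) m (mixedDeriv ζ H m i w)
      (weakDeriv (stripDomain ζ H) (basisVec i) (invBloch Λ w)) := by
  refine ⟨(hw.isWeakDeriv_mixed hm i).2.1, fun j => ?_⟩
  filter_upwards [hw.weakDeriv_invBloch_translate hζ hper i j,
    hw.blochCoeff_mixedDeriv hΛ hζ j hm i] with y h1 h2
  rw [h1, h2]

/-! ### `L²` estimates for the inverse transform and its gradient -/

theorem eLpNorm_two_sq {α : Type*} [MeasurableSpace α] (μ : Measure α) (f : α → ℂ) :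
    eLpNorm f 2 μ ^ 2 = ∫⁻ x, ‖f x‖ₑ ^ 2 ∂μ := by
  have := eLpNorm_nnreal_pow_eq_lintegral (μ := μ) (f := f) (p := 2) two_ne_zero
  simpa using this

theorem MemLp.eLpNorm_two_eq {α : Type*} [MeasurableSpace α] {μ : Measure α} {f : α → ℂ}
    (hf : MemLp f 2 μ) : eLpNorm f 2 μ = ENNReal.ofReal (Real.sqrt (∫ x, ‖f x‖ ^ 2 ∂μ)) := by
  rw [hf.eLpNorm_eq_integral_rpow_norm (by simp) (by simp), Real.sqrt_eq_rpow]
  simp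

/-- The decay estimate: on every cell meeting `T` the factor `|Λj|^m` is at least `r`, so dividing
by it gains `r⁻¹`. With `m = 0`, `r = 1` it gives boundedness on the strip; with `m = n`, `r =
(LΛ)^n` the tail bound. -/
theorem IsBlochPair.eLpNorm_le (hΛ : 0 < Λ) (hζ : Continuous ζ) (hper : Function.Periodic ζ Λ)
    {m : ℕ} {f : ℝ × (ℝ × ℝ) → ℂ} {g : ℝ × ℝ → ℂ} {J : Set ℤ} {r : ℝ} (hr : 0 < r)
    {T : Set (ℝ × ℝ)} (h : IsBlochPair Λ (stripDomain ζ H) m f g)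
    (hTΩ : T ⊆ stripDomain ζ H)
    (hT : ∀ j : ℤ, ∀ y ∈ cellDomain Λ ζ H, y + (Λ * (j : ℝ), 0) ∈ T → j ∈ J)
    (hJ : ∀ j ∈ J, r ≤ (|Λ * j|) ^ m) :
    eLpNorm g 2 (volume.restrict T) ≤
      ENNReal.ofReal r⁻¹ * eLpNorm f 2 (volume.restrict (dualCell Λ ×ˢ cellDomain Λ ζ H)) := by
  have hcell : cellDomain Λ ζ H ⊆ stripDomain ζ H := inter_subset_left
  rw [← ENNReal.pow_le_pow_left_iff two_ne_zero, mul_pow, eLpNorm_two_sq, eLpNorm_two_sq]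
  refine lintegral_iUnion_translates_le hΛ
    (h.1.aestronglyMeasurable.mono_measure (Measure.restrict_mono
      (prod_mono (subset_univ _) hcell) le_rfl)) (fun j => ?_)
    (stripDomain_subset_iUnion hΛ hper hTΩ hT) fun j hj => ?_
  · have := (LocallyIntegrableOn.integral_fiber (isOpen_stripDomain (H := H) hζ) h.1
      (contDiff_blochExp Λ j).continuous (-(Real.pi / Λ)) (Real.pi / Λ)).aestronglyMeasurable
    exact (this.const_mul _).mono_measure (Measure.restrict_mono hcell le_rfl)
  · filter_upwards [ae_restrict_of_ae_restrict_of_subset hcell (h.2 j)] with y hy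
    rw [hy, ← ofReal_norm, ← ofReal_norm, ← ENNReal.ofReal_mul (by positivity)]
    refine ENNReal.ofReal_le_ofReal ?_
    have e : ‖(-(Complex.I * Λ * j)) ^ m‖ = |Λ * j| ^ m := by
      simp [abs_mul]
    rw [norm_mul, e, ← div_eq_inv_mul, le_div_iff₀ hr, mul_comm]
    exact mul_le_mul_of_nonneg_right (hJ j hj) (norm_nonneg _)

theorem MemBlochSobolev.eLpNorm_le_norm (hw : MemBlochSobolev Λ ζ H n w) {m : ℕ} (hm : m ≤ n) :
    eLpNorm (alphaDeriv ζ H m w) 2 (volume.restrict (dualCell Λ ×ˢ cellDomain Λ ζ H)) ≤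
        ENNReal.ofReal (blochSobolevNorm Λ ζ H n w) ∧
      ∀ i, eLpNorm (mixedDeriv ζ H m i w) 2
        (volume.restrict (dualCell Λ ×ˢ cellDomain Λ ζ H)) ≤
        ENNReal.ofReal (blochSobolevNorm Λ ζ H n w) := by
  have h1 := hw.memLp_alphaDeriv m hm
  have h2 := hw.memLp_mixedDeriv m hm
  have i1 := (memLp_two_iff_integrable_sq_norm h1.1).1 h1
  have i2 := fun i => (memLp_two_iff_integrable_sq_norm (h2 i).1).1 (h2 i)
  have hint : Integrable (fun p => ‖alphaDeriv ζ H m w p‖ ^ 2 +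
      ∑ i : Fin 2, ‖mixedDeriv ζ H m i w p‖ ^ 2)
      (volume.restrict (dualCell Λ ×ˢ cellDomain Λ ζ H)) :=
    i1.add (integrable_finsetSum _ fun i _ => i2 i)
  have hle : ∫ p in dualCell Λ ×ˢ cellDomain Λ ζ H, (‖alphaDeriv ζ H m w p‖ ^ 2 +
      ∑ i : Fin 2, ‖mixedDeriv ζ H m i w p‖ ^ 2) ≤
      ∑ m ∈ Finset.range (n + 1), ∫ p in dualCell Λ ×ˢ cellDomain Λ ζ H,
        (‖alphaDeriv ζ H m w p‖ ^ 2 + ∑ i : Fin 2, ‖mixedDeriv ζ H m i w p‖ ^ 2) :=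
    Finset.single_le_sum (f := fun m => ∫ p in dualCell Λ ×ˢ cellDomain Λ ζ H,
        (‖alphaDeriv ζ H m w p‖ ^ 2 + ∑ i : Fin 2, ‖mixedDeriv ζ H m i w p‖ ^ 2))
      (fun m _ => integral_nonneg fun p => by positivity)
      (Finset.mem_range.2 (Nat.lt_succ_of_le hm))
  constructor
  · rw [MemLp.eLpNorm_two_eq h1]
    refine ENNReal.ofReal_le_ofReal (Real.sqrt_le_sqrt (le_trans ?_ hle))
    exact integral_mono i1 hint fun p => le_add_of_nonneg_right
      (Finset.sum_nonneg fun i _ => by positivity)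
  · intro i
    rw [MemLp.eLpNorm_two_eq (h2 i)]
    refine ENNReal.ofReal_le_ofReal (Real.sqrt_le_sqrt (le_trans ?_ hle))
    refine integral_mono (i2 i) hint fun p => ?_
    exact (Finset.single_le_sum (f := fun i => ‖mixedDeriv ζ H m i w p‖ ^ 2)
      (fun i _ => by positivity) (Finset.mem_univ i)).trans
      (le_add_of_nonneg_left (by positivity))

end BlochSobolev

/-! ### The sesquilinear forms -/

section Forms

theorem MemLp.exists_ae_norm_le {α : Type*} [MeasurableSpace α] {μ : Measure α} {f : α → ℝ}
    (hf : MemLp f ⊤ μ) : ∃ M : NNReal, ∀ᵐ x ∂μ, ‖f x‖ ≤ M := by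
  refine ⟨(eLpNormEssSup f μ).toNNReal, ?_⟩
  have htop : eLpNormEssSup f μ ≠ ⊤ := by
    have := hf.2
    rw [eLpNorm_exponent_top] at this
    exact this.ne
  filter_upwards [ae_le_eLpNormEssSup (f := f) (μ := μ)] with x hx
  rw [← ENNReal.coe_toNNReal htop, enorm_le_coe] at hx
  exact_mod_cast hx

/-- Cauchy–Schwarz in extended norms, so that one estimate serves for both integrability and size.
-/
theorem eLpNorm_one_mul_mul_conj_le {α : Type*} [MeasurableSpace α] {μ : Measure α}
    {c : α → ℝ} {a b : α → ℂ} {M : NNReal} (hcM : ∀ᵐ x ∂μ, ‖c x‖ ≤ M)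
    (ha : AEStronglyMeasurable a μ) (hb : AEStronglyMeasurable b μ)
    (hc : AEStronglyMeasurable c μ) :
    AEStronglyMeasurable (fun x => (c x : ℂ) * a x * conj (b x)) μ ∧
      eLpNorm (fun x => (c x : ℂ) * a x * conj (b x)) 1 μ ≤ M * eLpNorm a 2 μ * eLpNorm b 2 μ := by
  refine ⟨((Complex.continuous_ofReal.comp_aestronglyMeasurable hc).mul ha).mul
    (Complex.continuous_conj.comp_aestronglyMeasurable hb), ?_⟩
  calc eLpNorm (fun x => (c x : ℂ) * a x * conj (b x)) 1 μ
      ≤ eLpNorm (fun x => (M : ℝ) * (‖a x‖ * ‖b x‖)) 1 μ := by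
        refine eLpNorm_mono_ae_real ?_
        filter_upwards [hcM] with x hx
        rw [norm_mul, norm_mul, Complex.norm_real, RCLike.norm_conj, mul_assoc]
        gcongr
    _ ≤ M * eLpNorm a 2 μ * eLpNorm b 2 μ := by
        refine eLpNorm_le_eLpNorm_mul_eLpNorm'_of_norm ha hb
          (fun a b => (M : ℝ) * (‖a‖ * ‖b‖)) M (Filter.Eventually.of_forall fun x => ?_)
        simp [mul_assoc]

/-- The constant 5 counts four gradient terms and one zeroth-order term. -/
theorem eLpNorm_one_formIntegrand_le {Λ k : ℝ} {ζ : ℝ → ℝ} {H : ℝ}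
    {A : ℝ × ℝ → Matrix (Fin 2) (Fin 2) ℝ} {c : ℝ × ℝ → ℝ} {w z : ℝ × (ℝ × ℝ) → ℂ}
    {μ : Measure (ℝ × ℝ)} {M : NNReal} {r s : ENNReal}
    (hA : ∀ i j, AEStronglyMeasurable (fun x => (A x - 1) i j) μ)
    (hAM : ∀ i j, ∀ᵐ x ∂μ, ‖(A x - 1) i j‖ ≤ M)
    (hc : AEStronglyMeasurable (fun x => k ^ 2 * (c x - 1)) μ)
    (hcM : ∀ᵐ x ∂μ, ‖k ^ 2 * (c x - 1)‖ ≤ M)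
    (hwm : AEStronglyMeasurable (invBloch Λ w) μ)
    (hwm' : ∀ i, AEStronglyMeasurable (weakDeriv (stripDomain ζ H) (basisVec i) (invBloch Λ w)) μ)
    (hzm : AEStronglyMeasurable (invBloch Λ z) μ)
    (hzm' : ∀ i, AEStronglyMeasurable (weakDeriv (stripDomain ζ H) (basisVec i) (invBloch Λ z)) μ)
    (hw : eLpNorm (invBloch Λ w) 2 μ ≤ r)
    (hw' : ∀ i, eLpNorm (weakDeriv (stripDomain ζ H) (basisVec i) (invBloch Λ w)) 2 μ ≤ r)
    (hz : eLpNorm (invBloch Λ z) 2 μ ≤ s)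
    (hz' : ∀ i, eLpNorm (weakDeriv (stripDomain ζ H) (basisVec i) (invBloch Λ z)) 2 μ ≤ s) :
    AEStronglyMeasurable (formIntegrand Λ k ζ H A c w z) μ ∧
      eLpNorm (formIntegrand Λ k ζ H A c w z) 1 μ ≤ 5 * (M * r * s) := by
  have hgrad := fun i j => eLpNorm_one_mul_mul_conj_le (hAM i j) (hwm' j) (hzm' i) (hA i j)
  have hmass := eLpNorm_one_mul_mul_conj_le hcM hwm hzm hc
  have hgrad_le := fun i j => (hgrad i j).2.trans
    (mul_le_mul' (mul_le_mul' le_rfl (hw' j)) (hz' i))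
  have hmass_le := hmass.2.trans (mul_le_mul' (mul_le_mul' le_rfl hw) hz)
  have e : formIntegrand Λ k ζ H A c w z = (∑ i : Fin 2, ∑ j : Fin 2,
      fun x => (((A x - 1) i j : ℝ) : ℂ) *
        weakDeriv (stripDomain ζ H) (basisVec j) (invBloch Λ w) x *
        conj (weakDeriv (stripDomain ζ H) (basisVec i) (invBloch Λ z) x)) -
      fun x => ((k ^ 2 * (c x - 1) : ℝ) : ℂ) * invBloch Λ w x * conj (invBloch Λ z x) := by
    ext x; simp [formIntegrand]
  rw [e]
  have m1 : ∀ i, AEStronglyMeasurable (∑ j : Fin 2, fun x => (((A x - 1) i j : ℝ) : ℂ) *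
      weakDeriv (stripDomain ζ H) (basisVec j) (invBloch Λ w) x *
        conj (weakDeriv (stripDomain ζ H) (basisVec i) (invBloch Λ z) x)) μ := fun i =>
    Finset.aestronglyMeasurable_sum _ fun j _ => (hgrad i j).1
  have m2 := Finset.aestronglyMeasurable_sum Finset.univ fun i _ => m1 i
  refine ⟨m2.sub hmass.1, (eLpNorm_sub_le m2 hmass.1 le_rfl).trans ?_⟩
  calc _ ≤ (∑ i : Fin 2, ∑ j : Fin 2, (M : ENNReal) * r * s) + M * r * s := by
        refine add_le_add ((eLpNorm_sum_le (fun i _ => m1 i) le_rfl).trans ?_) hmass_le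
        refine Finset.sum_le_sum fun i _ =>
          (eLpNorm_sum_le (fun j _ => (hgrad i j).1) le_rfl).trans ?_
        exact Finset.sum_le_sum fun j _ => hgrad_le i j
    _ = 5 * (M * r * s) := by
        simp only [Finset.sum_const, Finset.card_univ, Fintype.card_fin, nsmul_eq_mul]
        push_cast; ring

/-- Outside `S` both `A - I` and `c - 1` vanish. -/
theorem formIntegrand_cut (Λ k : ℝ) (ζ : ℝ → ℝ) (H : ℝ) (S : Set (ℝ × ℝ))
    (A : ℝ × ℝ → Matrix (Fin 2) (Fin 2) ℝ) (c : ℝ × ℝ → ℝ) (w z : ℝ × (ℝ × ℝ) → ℂ) :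
    formIntegrand Λ k ζ H (cutA S A) (cutC S c) w z =
      S.indicator (formIntegrand Λ k ζ H A c w z) := by
  ext x
  by_cases hx : x ∈ S <;> simp [formIntegrand, cutA, cutC, hx]

/-- The asymmetric range `-L+1, …, L` contains every `j` with `|j| < L`. -/
theorem mem_of_add_mem_diff_truncDomain {Λ H : ℝ} {ζ : ℝ → ℝ} {L : ℕ} (j : ℤ) (y : ℝ × ℝ)
    (hy : y ∈ cellDomain Λ ζ H)
    (h : y + (Λ * (j : ℝ), 0) ∈ stripDomain ζ H \ truncDomain Λ ζ H L) : (L : ℤ) ≤ |j| := by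
  by_contra hlt
  rw [not_le, abs_lt] at hlt
  exact h.2 (mem_biUnion (x := j) ⟨by linarith [hlt.1], hlt.2.le⟩ (mem_image_of_mem _ hy))

end Forms

end
-- The truncation estimate
theorem mainTheorem9 (Λ k H₀ H : ℝ) (hΛ : 0 < Λ) (ζ ζp : ℝ → ℝ)
    (hζ : ∃ K, LipschitzWith K ζ) (hζper : Function.Periodic ζ Λ)
    (hζp : ∃ K, LipschitzWith K ζp) (hζpb : ∃ M, ∀ t, |ζp t| ≤ M)
    (hζH₀ : ∀ t, ζ t < H₀) (hH₀H : H₀ < H)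
    (Θ : ℝ × ℝ → ℝ × ℝ) (hΘ : IsDomainMap ζ ζp H₀ Θ)
    (hA : ∀ i j, MemLp (fun x => coeffA Θ x i j) ⊤ (volume.restrict (stripDomain ζ H)))
    (hc : MemLp (coeffC Θ) ⊤ (volume.restrict (stripDomain ζ H)))
    (n : ℕ) :
    ∃ C > 0, ∃ L₀ : ℕ, ∀ L : ℕ, L₀ ≤ L → ∀ w z : ℝ × (ℝ × ℝ) → ℂ,
      MemBlochSobolev Λ ζ H n w → MemBlochSobolev Λ ζ H 0 z →
        (∀ i, HasWeakDeriv (stripDomain ζ H) (basisVec i) (invBloch Λ w)) ∧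
        (∀ i, HasWeakDeriv (stripDomain ζ H) (basisVec i) (invBloch Λ z)) ∧
        IntegrableOn (formIntegrand Λ k ζ H (coeffA Θ) (coeffC Θ) w z) (stripDomain ζ H) ∧
        IntegrableOn (formIntegrand Λ k ζ H (cutA (truncDomain Λ ζ H L) (coeffA Θ))
          (cutC (truncDomain Λ ζ H L) (coeffC Θ)) w z) (stripDomain ζ H) ∧
        ‖formBL Λ k ζ H Θ L w z - formB Λ k ζ H Θ w z‖ ≤
          C * |(L : ℝ) * Λ| ^ (-(n : ℤ)) *
            blochSobolevNorm Λ ζ H n w * blochSobolevNorm Λ ζ H 0 z := by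
  obtain ⟨K, hK⟩ := hζ
  have hζc := hK.continuous
  set Ω := stripDomain ζ H with hΩdef
  have hΩ : MeasurableSet Ω := (isOpen_stripDomain hζc).measurableSet
  have hA1 : ∀ i j, MemLp (fun x => (coeffA Θ x - 1) i j) ⊤ (volume.restrict Ω) := fun i j =>
    (hA i j).sub (memLp_top_const ((1 : Matrix (Fin 2) (Fin 2) ℝ) i j))
  have hc1 : MemLp (fun x => k ^ 2 * (coeffC Θ x - 1)) ⊤ (volume.restrict Ω) :=
    (hc.sub (memLp_top_const (1 : ℝ))).const_mul (k ^ 2)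
  choose MA hMA using fun i j => MemLp.exists_ae_norm_le (hA1 i j)
  obtain ⟨Mc, hMc⟩ := MemLp.exists_ae_norm_le hc1
  -- A common bound for all coefficients; the summand 1 makes `C` positive.
  set M : NNReal := (∑ i, ∑ j, MA i j) + Mc + 1 with hM
  have hMA' : ∀ i j, ∀ᵐ x ∂volume.restrict Ω, ‖(coeffA Θ x - 1) i j‖ ≤ M := fun i j => by
    filter_upwards [hMA i j] with x hx
    refine hx.trans (NNReal.coe_le_coe.2 ?_)
    have h1 : MA i j ≤ ∑ j, MA i j := Finset.single_le_sum (fun _ _ => zero_le) (Finset.mem_univ j)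
    have h2 : ∑ j, MA i j ≤ ∑ i, ∑ j, MA i j :=
      Finset.single_le_sum (f := fun i => ∑ j, MA i j) (fun _ _ => zero_le) (Finset.mem_univ i)
    exact (h1.trans h2).trans (by rw [hM, add_assoc]; exact le_self_add)
  have hMc' : ∀ᵐ x ∂volume.restrict Ω, ‖k ^ 2 * (coeffC Θ x - 1)‖ ≤ M := by
    filter_upwards [hMc] with x hx
    refine hx.trans (NNReal.coe_le_coe.2 ?_)
    rw [hM, add_right_comm]; exact le_add_self
  have hMpos : (0 : ℝ) < M := by
    have : (0 : NNReal) < M := by rw [hM]; positivity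
    exact_mod_cast this
  -- `L₀ = 1` ensures `LΛ > 0`, so that dividing by `(LΛ)^n` makes sense. The constant does not
  -- depend on `n`.
  refine ⟨5 * M, by positivity, 1, fun L hL w z hw hz => ?_⟩
  have hdw := hw.hasWeakDeriv_invBloch hζc hζper
  have hdz := hz.hasWeakDeriv_invBloch hζc hζper
  set T := Ω \ truncDomain Λ ζ H L with hTdef
  have hTΩ : T ⊆ Ω := sdiff_subset
  have hr : 0 < ((L : ℝ) * Λ) ^ n := by
    have : (0 : ℝ) < L := by exact_mod_cast hL
    positivity
  have hJ : ∀ j ∈ {j : ℤ | (L : ℤ) ≤ |j|}, ((L : ℝ) * Λ) ^ n ≤ |Λ * j| ^ n := fun j hj => by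
    have h1 : (L : ℝ) ≤ |(j : ℝ)| := by exact_mod_cast hj
    rw [abs_mul, abs_of_pos hΛ, mul_comm Λ]
    gcongr
  have mwu : AEStronglyMeasurable (invBloch Λ w) (volume.restrict Ω) :=
    (hdw 0).isWeakDeriv.1.aestronglyMeasurable
  have mwd := fun i => (hdw i).isWeakDeriv.2.1.aestronglyMeasurable
  have mzu : AEStronglyMeasurable (invBloch Λ z) (volume.restrict Ω) :=
    (hdz 0).isWeakDeriv.1.aestronglyMeasurable
  have mzd := fun i => (hdz i).isWeakDeriv.2.1.aestronglyMeasurable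
  -- The case `m = 0` of the decay estimate: the factor is `1` on every cell, including `j = 0`.
  have hfull : ∀ {N : ℕ} {v : ℝ × (ℝ × ℝ) → ℂ}, MemBlochSobolev Λ ζ H N v →
      eLpNorm (invBloch Λ v) 2 (volume.restrict Ω) ≤
        ENNReal.ofReal (blochSobolevNorm Λ ζ H N v) ∧
      ∀ i, eLpNorm (weakDeriv Ω (basisVec i) (invBloch Λ v)) 2 (volume.restrict Ω) ≤
        ENNReal.ofReal (blochSobolevNorm Λ ζ H N v) := fun {N v} hv => by
    have hN := hv.eLpNorm_le_norm (Nat.zero_le N)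
    constructor
    · refine le_trans ?_ hN.1
      simpa using (hv.isBlochPair hΛ hζc hζper (Nat.zero_le N)).eLpNorm_le (J := univ) (r := 1)
        hΛ hζc hζper one_pos subset_rfl (fun _ _ _ _ => mem_univ _) (by simp)
    · intro i
      refine le_trans ?_ (hN.2 i)
      simpa using (hv.isBlochPair_weakDeriv hΛ hζc hζper (Nat.zero_le N) i).eLpNorm_le
        (J := univ) (r := 1)
        hΛ hζc hζper one_pos subset_rfl (fun _ _ _ _ => mem_univ _) (by simp)
  obtain ⟨hzu, hzg⟩ := hfull hz
  obtain ⟨hwu, hwg⟩ := hfull hw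
  have hwN := hw.eLpNorm_le_norm le_rfl
  -- All `n` derivatives are spent on `w`; for `z` the bound on the whole strip suffices.
  have hwuT : eLpNorm (invBloch Λ w) 2 (volume.restrict T) ≤
      ENNReal.ofReal (((L : ℝ) * Λ) ^ n)⁻¹ * ENNReal.ofReal (blochSobolevNorm Λ ζ H n w) :=
    ((hw.isBlochPair hΛ hζc hζper le_rfl).eLpNorm_le hΛ hζc hζper hr hTΩ
      mem_of_add_mem_diff_truncDomain hJ).trans (mul_le_mul' le_rfl hwN.1)
  have hwgT : ∀ i, eLpNorm (weakDeriv Ω (basisVec i) (invBloch Λ w)) 2 (volume.restrict T) ≤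
      ENNReal.ofReal (((L : ℝ) * Λ) ^ n)⁻¹ * ENNReal.ofReal (blochSobolevNorm Λ ζ H n w) :=
    fun i => ((hw.isBlochPair_weakDeriv hΛ hζc hζper le_rfl i).eLpNorm_le hΛ hζc hζper hr hTΩ
      mem_of_add_mem_diff_truncDomain hJ).trans (mul_le_mul' le_rfl (hwN.2 i))
  have hmono : volume.restrict T ≤ volume.restrict Ω := Measure.restrict_mono hTΩ le_rfl
  have hint : IntegrableOn (formIntegrand Λ k ζ H (coeffA Θ) (coeffC Θ) w z) Ω := by
    rw [IntegrableOn, ← memLp_one_iff_integrable]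
    obtain ⟨h1, h2⟩ := eLpNorm_one_formIntegrand_le (fun i j => (hA1 i j).1) hMA' hc1.1 hMc'
      mwu mwd mzu mzd hwu hwg hzu hzg
    refine ⟨h1, h2.trans_lt ?_⟩
    finiteness
  have hST := measurableSet_truncDomain (Λ := Λ) (H := H) hζc L
  refine ⟨hdw, hdz, hint, ?_, ?_⟩
  · rw [formIntegrand_cut]
    exact hint.indicator hST
  -- The two forms agree on `Ω^{L,Λ}_H`, so only the tail of `b` survives.
  have hdiff : formBL Λ k ζ H Θ L w z - formB Λ k ζ H Θ w z =
      -∫ x in T, formIntegrand Λ k ζ H (coeffA Θ) (coeffC Θ) w z x := by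
    rw [formBL, formB, sesqForm, sesqForm, formIntegrand_cut, setIntegral_indicator hST,
      ← integral_inter_add_sdiff hST hint]
    ring
  obtain ⟨-, h2⟩ := eLpNorm_one_formIntegrand_le (fun i j => (hA1 i j).1.mono_measure hmono)
    (fun i j => ae_mono hmono (hMA' i j)) (hc1.1.mono_measure hmono) (ae_mono hmono hMc')
    (mwu.mono_measure hmono) (fun i => (mwd i).mono_measure hmono)
    (mzu.mono_measure hmono) (fun i => (mzd i).mono_measure hmono) hwuT hwgT
    ((eLpNorm_mono_measure _ hmono).trans hzu) fun i => (eLpNorm_mono_measure _ hmono).trans (hzg i)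
  have hNw : 0 ≤ blochSobolevNorm Λ ζ H n w := Real.sqrt_nonneg _
  have hNz : 0 ≤ blochSobolevNorm Λ ζ H 0 z := Real.sqrt_nonneg _
  have hpow : |(L : ℝ) * Λ| ^ (-(n : ℤ)) = (((L : ℝ) * Λ) ^ n)⁻¹ := by
    rw [abs_of_nonneg (by positivity), zpow_neg, zpow_natCast]
  rw [hdiff, norm_neg, hpow, ← ENNReal.ofReal_le_ofReal_iff (by positivity), ofReal_norm]
  refine (enorm_integral_le_lintegral_enorm _).trans ?_
  rw [← eLpNorm_one_eq_lintegral_enorm]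
  refine h2.trans (le_of_eq ?_)
  rw [ENNReal.ofReal_mul (by positivity), ENNReal.ofReal_mul (by positivity),
    ENNReal.ofReal_mul (by positivity), ENNReal.ofReal_mul (by positivity),
    ENNReal.ofReal_coe_nnreal, ENNReal.ofReal_ofNat]
  ring
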